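/- **Setting.** Fix a generator of bilinear groups: for security parameter $\lambda$ it chooses (a description of) groups $\mathbb G=\langle g\rangle$, $\mathbb G_T$ of prime order $p$ with a bilinear map $e:\mathbb G\times\mathbb G\to\mathbb G_T$, $e(u^a,v^b)=e(u,v)^{ab}$, $e(g,g)\neq1$; group elements are uniquely represented by strings of length polynomial in $\lambda$, and group operations and $e$ are computable in polynomial time. Let $U$ be a universe of attributes of size polynomial in $\lambda$. An LSSS over $\mathbb Z_p$ is $\mathcal M=(\boldsymbol H,\psi)$ with $\boldsymbol H=(\boldsymbol h_1,\dots,\boldsymbol h_\ell)^\top\in\mathbb Z_p^{\ell\times d}$, $d\ge 1$, $\psi:[\ell]\to U$. It realizes the access structure $\Gamma$ on the participants $\psi([\ell])$ in which $A$ is authorized iff $\boldsymbol t=(1,0,\dots,0)^\top$ lies in the span of $\{\boldsymbol h_i:\psi(i)\in A\}$. It is ideal if $\psi$ is injective; $\Gamma$ is connected if every participant lies in a minimal authorized set. The contraction of $\Gamma$ at a set $Q$ of participants is $\Gamma_{\cdot Q}=\{A\subseteq\psi([\ell])\setminus Q: A\cup Q\in\Gamma\}$. A set $S\subseteq U$ satisfies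 an access structure on $P\subseteq U$ if $S\cap P$ is authorized. **Waters' CP-ABE scheme.** Setup: $\beta,a\in\mathbb Z_p$ and $T_x\in\mathbb G$ ($x\in U$) uniform; $\mathrm{PK}=(g,g^a,e(g,g)^\beta,(T_x)_{x\in U})$, $\mathrm{MSK}=g^\beta$. KeyGen for $A\subseteq U$: $t\in\mathbb Z_p$ uniform; $\mathrm{SK}=(A,g^\beta g^{at},g^t,(T_x^t)_{x\in A})$. Encryption of $M\in\mathbb G_T$ under $\mathcal M$: $\boldsymbol v=(s,v_2,\dots,v_d)\in\mathbb Z_p^d$ and $r_1,\dots,r_\ell\in\mathbb Z_p$ uniform; $\mathrm{CT}=(\mathcal M,C,C',(C_i,D_i)_{i\in[\ell]})$ with $C=M\,e(g,g)^{\beta s}$, $C'=g^s$, $C_i=g^{a\,\boldsymbol h_i^\top\boldsymbol v}T_{\psi(i)}^{-r_i}$, $D_i=g^{r_i}$. **CP-ABE-CAS scheme.** Setup, key generation and ciphertexts are those of Waters' scheme; encryption also outputs the contraction key $(r_i)_{i\in[\ell]}$. Let $\mathcal M$ be ideal, realizing a connected $\Gamma$, and let $Q=\{y\}$ be unauthorized,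 $y=\psi(j)$. Let $k\ge2$ be the least column with $h_{jk}\ne0$. With $\mathrm{CK}_Q=r_j$, contraction outputs $\mathrm{CT}_{\cdot Q}=(\mathcal M',C,C',(C'_i,D_i)_{i\ne j})$, where $C'_i=C_i\,(C_jT_y^{r_j})^{-h_{ik}/h_{jk}}$ and $\mathcal M'$ has rows $\boldsymbol h_i-\frac{h_{ik}}{h_{jk}}\boldsymbol h_j$, labelled $\psi(i)$, for $i\neq j$. **Games.** In both games the challenger runs Setup and gives $\mathrm{PK}$ to the adversary, which may adaptively ask for private keys of attribute sets before and after its challenge. *$G_1$*: the adversary declares messages $M_0,M_1\in\mathbb G_T$ of equal length and an LSSS $\mathcal M$ realizing the access structure $\Gamma^*$; it receives an encryption of $M_b$ under $\mathcal M$ for a uniform bit $b$; no queried set may satisfy $\Gamma^*$. *$G_2$*: the adversary declares messages $M_0,M_1\in\mathbb G_T$ of equal length, an ideal LSSS $\mathcal M$ realizing a connected access structure $\Gamma^*$, and an unauthorized $Q=\{y\}$, $y$ a participant; it receives $(\mathrm{CT}^*,\mathrm{CT}^*_{\cdot Q},\mathrm{CK}_Q)$, where $\mathrm{CT}^*$ encrypts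 $M_b$ under $\mathcal M$ for a uniform bit $b$; no queried set may satisfy $\Gamma^*_{\cdot Q}$. Finally the adversary outputs $b'$; its advantage is $\Pr[b'=b]-\tfrac12$. The scheme is secure in the game if every probabilistic polynomial-time adversary that obeys the rules has at most a negligible advantage (as a function of $\lambda$). **Theorem.** If Waters' CP-ABE scheme is secure in $G_1$, then the CP-ABE-CAS scheme is secure in $G_2$. -/

import Mathlib

noncomputable section

namespace CPABE

/-! ### Machine model

A uniform machine model with logarithmic cost: programs act on finite binary trees whose leaves
are natural numbers written in binary; every elementary instruction is charged at least the number
of bits it reads.  Up to polynomial factors this is Turing machine time. -/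

/-- Data handled by machines. -/
inductive Data : Type
  | num (n : ℕ)
  | cons (a b : Data)

namespace Data

/-- Bit length of a datum. -/
def size : Data → ℕ
  | num n => Nat.size n + 1
  | cons a b => a.size + b.size + 1

def head : Data → Data
  | num _ => num 0
  | cons a _ => a

def tail : Data → Data
  | num _ => num 0
  | cons _ b => b

/-- Value of a leaf. -/
def val : Data → ℕ
  | num n => n
  | cons _ _ => 0

/-- `num 1` on leaves, `num 0` on inner nodes. -/
def isLeaf : Data → Data
  | num _ => num 1
  | cons _ _ => num 0

/-- Finite sequences as data, terminated by the leaf `0`. -/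
def ofList : List Data → Data
  | [] => num 0
  | x :: xs => cons x (ofList xs)

/-- The unary string `1^k`. -/
def unary (k : ℕ) : Data := ofList (List.replicate k (num 1))

end Data

/-- Arithmetic instructions. -/
inductive Op : Type
  | add | sub | mul | div | mod

/-- Effect of an arithmetic instruction on a pair of leaves. -/
def Op.apply (o : Op) (x : Data) : Data :=
  let a := x.head.val
  let b := x.tail.val
  match o with
  | add => Data.num (a + b)
  | sub => Data.num (a - b)
  | mul => Data.num (a * b)
  | div => Data.num (a / b)
  | mod => Data.num (a % b)

/-- Programs. -/
inductive Code : Type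
  | id
  | lit (n : ℕ)
  | fst
  | snd
  | isLeaf
  | op (o : Op)
  | pair (f g : Code)
  | comp (g f : Code)
  | ite (c f g : Code)
  | loop (f : Code)

/-- `Runs c x y t`: on input `x` the program `c` halts with output `y` after time `t`.
`loop f` iterates `f`, continuing on the tail of the output of `f` until its head is the leaf `0`. -/
inductive Runs : Code → Data → Data → ℕ → Prop
  | id (x) : Runs .id x x (1 + x.size)
  | lit (n x) : Runs (.lit n) x (.num n) (1 + x.size + Nat.size n)
  | fst (x) : Runs .fst x x.head (1 + x.size)
  | snd (x) : Runs .snd x x.tail (1 + x.size)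
  | isLeaf (x) : Runs .isLeaf x x.isLeaf (1 + x.size)
  | op (o x) : Runs (.op o) x (o.apply x) (1 + x.size)
  | pair {f g x y z s t} : Runs f x y s → Runs g x z t →
      Runs (.pair f g) x (.cons y z) (1 + s + t)
  | comp {f g x y z s t} : Runs f x y s → Runs g y z t → Runs (.comp g f) x z (1 + s + t)
  | iteTrue {c f g x y z s t} : Runs c x y s → y ≠ .num 0 → Runs f x z t →
      Runs (.ite c f g) x z (1 + s + t)
  | iteFalse {c f g x y z s t} : Runs c x y s → y = .num 0 → Runs g x z t →
      Runs (.ite c f g) x z (1 + s + t)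
  | loopStop {f x y s} : Runs f x y s → y.head = .num 0 → Runs (.loop f) x y.tail (1 + s)
  | loopNext {f x y z s t} : Runs f x y s → y.head ≠ .num 0 → Runs (.loop f) y.tail z t →
      Runs (.loop f) x z (1 + s + t)

/-- Functions computed by a program in time polynomial in the length of the input. -/
def PolyTime (f : Data → Data) : Prop :=
  ∃ (c : Code) (q : Polynomial ℕ), ∀ x, ∃ t, t ≤ q.eval x.size ∧ Runs c x (f x) t

/-! ### Bilinear groups -/

/-- Power with exponent in `ℤ/p`, for groups of order `p`. -/
def pw {G : Type} [Group G] {p : ℕ} (u : G) (x : ZMod p) : G := u ^ x.val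

/-- A generator of bilinear groups of prime order.  `gen k` is the distribution of the bilinear group
chosen for the security parameter `k`; group elements have unique representations of polynomial
length, and the group operations and the pairing are computable in polynomial time from the
description `desc i` of the group. -/
structure BilinearGenerator where
  ι : Type
  p : ι → ℕ
  prime : ∀ i, Fact (p i).Prime
  G : ι → Type
  GT : ι → Type
  groupG : ∀ i, CommGroup (G i)
  groupGT : ∀ i, CommGroup (GT i)
  fintypeG : ∀ i, Fintype (G i)
  fintypeGT : ∀ i, Fintype (GT i)
  card_G : ∀ i, Fintype.card (G i) = p i
  card_GT : ∀ i, Fintype.card (GT i) = p i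
  g : ∀ i, G i
  g_generates : ∀ i (u : G i), u ∈ Subgroup.zpowers (g i)
  e : ∀ i, G i → G i → GT i
  bilinear : ∀ i (u v : G i) (a b : ZMod (p i)), e i (pw u a) (pw v b) = pw (e i u v) (a * b)
  nondegenerate : ∀ i, e i (g i) (g i) ≠ 1
  gen : ℕ → PMF ι
  desc : ι → Data
  encG : ∀ i, G i → Data
  encGT : ∀ i, GT i → Data
  encG_injective : ∀ i, Function.Injective (encG i)
  encGT_injective : ∀ i, Function.Injective (encGT i)
  poly_length : ∃ q : Polynomial ℕ, ∀ (k : ℕ), ∀ i ∈ (gen k).support,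
    (Data.num (p i)).size ≤ q.eval k ∧ (desc i).size ≤ q.eval k ∧
    (∀ u, (encG i u).size ≤ q.eval k) ∧ (∀ z, (encGT i z).size ≤ q.eval k)
  mulG_poly : ∃ f, PolyTime f ∧ ∀ i (u v : G i),
    f (.cons (desc i) (.cons (encG i u) (encG i v))) = encG i (u * v)
  invG_poly : ∃ f, PolyTime f ∧ ∀ i (u : G i), f (.cons (desc i) (encG i u)) = encG i u⁻¹
  mulGT_poly : ∃ f, PolyTime f ∧ ∀ i (z w : GT i),
    f (.cons (desc i) (.cons (encGT i z) (encGT i w))) = encGT i (z * w)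
  invGT_poly : ∃ f, PolyTime f ∧ ∀ i (z : GT i), f (.cons (desc i) (encGT i z)) = encGT i z⁻¹
  pairing_poly : ∃ f, PolyTime f ∧ ∀ i (u v : G i),
    f (.cons (desc i) (.cons (encG i u) (encG i v))) = encGT i (e i u v)

attribute [instance] BilinearGenerator.prime BilinearGenerator.groupG BilinearGenerator.groupGT
  BilinearGenerator.fintypeG BilinearGenerator.fintypeGT

/-! ### Access structures and linear secret sharing schemes

The universe of attributes is `Fin n`. -/

/-- The contraction of a family `Γ` at `Q`, a family of subsets of the complement of `Q`. -/
def contraction {n : ℕ} (Γ : Set (Finset (Fin n))) (Q : Finset (Fin n)) :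
    Set (Finset (Fin n)) :=
  {A | Disjoint A Q ∧ A ∪ Q ∈ Γ}

/-- A linear secret sharing scheme (monotone span program) over `ℤ/p` with target vector
`(1, 0, …, 0)`: a matrix with `rows` rows and `cols + 1` columns, and the attribute `ψ i` of each
row.  Its participants are the attributes that label a row. -/
structure LSSS (p n : ℕ) where
  rows : ℕ
  cols : ℕ
  H : Matrix (Fin rows) (Fin (cols + 1)) (ZMod p)
  ψ : Fin rows → Fin n

namespace LSSS

variable {p n : ℕ} [Fact p.Prime]

/-- The sets of participants. -/
def participants (M : LSSS p n) : Finset (Fin n) := Finset.univ.image M.ψ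

/-- The access structure over the participants that is realized by the scheme: a set of participants
is authorized iff the target vector is a linear combination of its rows. -/
def access (M : LSSS p n) : Set (Finset (Fin n)) :=
  {A | A ⊆ M.participants ∧
    (Pi.single 0 1 : Fin (M.cols + 1) → ZMod p) ∈
      Submodule.span (ZMod p) (M.H '' {i | M.ψ i ∈ A})}

/-- Ideal: every participant holds one row. -/
def Ideal (M : LSSS p n) : Prop := Function.Injective M.ψ

/-- Connected: every participant belongs to a minimal authorized set. -/
def Connected (M : LSSS p n) : Prop :=
  ∀ x ∈ M.participants, ∃ A, x ∈ A ∧ Minimal (· ∈ M.access) A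

/-- The first column other than the first one where row `j` does not vanish. -/
def pivot (M : LSSS p n) (j : Fin M.rows) : Fin (M.cols + 1) :=
  ((List.finRange (M.cols + 1)).find? fun k => decide (k ≠ 0 ∧ M.H j k ≠ 0)).getD 0

/-- Increasing enumeration of the indices different from `j`. -/
def skip {l : ℕ} (j : Fin l) (i : Fin (l - 1)) : Fin l :=
  if i.1 < j.1 then ⟨i.1, by omega⟩ else ⟨i.1 + 1, by omega⟩

/-- `h_{ik} / h_{jk}`, where `k` is the pivot of row `j`. -/
def coeff (M : LSSS p n) (j i : Fin M.rows) : ZMod p :=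
  M.H i (M.pivot j) / M.H j (M.pivot j)

/-- The scheme for the contraction at the attribute `ψ j`: row `j` is deleted and
`h_i` is replaced by `h_i - (h_{ik} / h_{jk}) h_j`. -/
def contract (M : LSSS p n) (j : Fin M.rows) : LSSS p n where
  rows := M.rows - 1
  cols := M.cols
  H := fun i => M.H (skip j i) - M.coeff j (skip j i) • M.H j
  ψ := fun i => M.ψ (skip j i)

end LSSS

/-! ### Waters' scheme and the scheme with contractions -/

variable (B : BilinearGenerator)

structure PublicKey (i : B.ι) (n : ℕ) where
  g : B.G i
  ga : B.G i
  egg : B.GT i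
  T : Fin n → B.G i

structure SecretKey (i : B.ι) (n : ℕ) where
  A : Finset (Fin n)
  K : B.G i
  L : B.G i
  Kx : A → B.G i

structure Ciphertext (i : B.ι) {n : ℕ} (M : LSSS (B.p i) n) where
  C : B.GT i
  C' : B.G i
  Ci : Fin M.rows → B.G i
  Di : Fin M.rows → B.G i

variable {B} {i : B.ι} {n : ℕ}

/-- Setup in the chosen bilinear group: public key and master secret key `g ^ β`. -/
def setup (i : B.ι) (n : ℕ) : PMF (PublicKey B i n × B.G i) :=
  (PMF.uniformOfFintype (ZMod (B.p i))).bind fun β =>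
  (PMF.uniformOfFintype (ZMod (B.p i))).bind fun a =>
  (PMF.uniformOfFintype (Fin n → B.G i)).map fun T =>
    (⟨B.g i, pw (B.g i) a, pw (B.e i (B.g i) (B.g i)) β, T⟩, pw (B.g i) β)

def keyGen (pk : PublicKey B i n) (msk : B.G i) (A : Finset (Fin n)) : PMF (SecretKey B i n) :=
  (PMF.uniformOfFintype (ZMod (B.p i))).map fun t =>
    ⟨A, msk * pw pk.ga t, pw pk.g t, fun x => pw (pk.T x) t⟩

/-- The ciphertext obtained with the random choices `v = (s, v_2, …, v_d)` and `r`. -/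
def encryptWith (pk : PublicKey B i n) (m : B.GT i) (M : LSSS (B.p i) n)
    (v : Fin (M.cols + 1) → ZMod (B.p i)) (r : Fin M.rows → ZMod (B.p i)) : Ciphertext B i M where
  C := m * pw pk.egg (v 0)
  C' := pw pk.g (v 0)
  Ci := fun l => pw pk.ga (M.H l ⬝ᵥ v) * pw (pk.T (M.ψ l)) (-r l)
  Di := fun l => pw pk.g (r l)

/-- Waters' encryption. -/
def encrypt (pk : PublicKey B i n) (m : B.GT i) (M : LSSS (B.p i) n) : PMF (Ciphertext B i M) :=
  (PMF.uniformOfFintype (Fin (M.cols + 1) → ZMod (B.p i))).bind fun v =>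
  (PMF.uniformOfFintype (Fin M.rows → ZMod (B.p i))).map fun r => encryptWith pk m M v r

/-- Modified encryption: also outputs the contraction key `(r_l)`, one entry for each row. -/
def encryptStar (pk : PublicKey B i n) (m : B.GT i) (M : LSSS (B.p i) n) :
    PMF (Ciphertext B i M × (Fin M.rows → ZMod (B.p i))) :=
  (PMF.uniformOfFintype (Fin (M.cols + 1) → ZMod (B.p i))).bind fun v =>
  (PMF.uniformOfFintype (Fin M.rows → ZMod (B.p i))).map fun r => (encryptWith pk m M v r, r)

/-- Contraction of a ciphertext at `Q = {ψ j}`, with restricted contraction key `rj`. -/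
def contractCT (pk : PublicKey B i n) {M : LSSS (B.p i) n} (ct : Ciphertext B i M)
    (j : Fin M.rows) (rj : ZMod (B.p i)) : Ciphertext B i (M.contract j) where
  C := ct.C
  C' := ct.C'
  Ci := fun l => ct.Ci (LSSS.skip j l) *
    pw (ct.Ci j * pw (pk.T (M.ψ j)) rj) (-M.coeff j (LSSS.skip j l))
  Di := fun l => ct.Di (LSSS.skip j l)

/-! ### Representation of keys, policies and ciphertexts as data -/

def encZ {p : ℕ} (x : ZMod p) : Data := .num x.val

def encAttr (x : Fin n) : Data := .num x.val

/-- Attribute sets are represented by increasing lists. -/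
def encSet (A : Finset (Fin n)) : Data := .ofList ((A.sort (· ≤ ·)).map encAttr)

/-- Finite families as data. -/
def encFam {l : ℕ} (f : Fin l → Data) : Data := .ofList (List.ofFn f)

def encLSSS {p : ℕ} (M : LSSS p n) : Data :=
  .cons (.num M.cols)
    (encFam fun l => .cons (encAttr (M.ψ l)) (encFam fun c => encZ (M.H l c)))

/-- The public key, together with the order and the description of the bilinear group. -/
def encPK (pk : PublicKey B i n) : Data :=
  .ofList [.num (B.p i), B.desc i, B.encG i pk.g, B.encG i pk.ga, B.encGT i pk.egg,
    encFam fun x => B.encG i (pk.T x)]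

def encSK (sk : SecretKey B i n) : Data :=
  .ofList [encSet sk.A, B.encG i sk.K, B.encG i sk.L,
    encFam fun l => B.encG i (sk.Kx (sk.A.orderIsoOfFin rfl l))]

def encCT {M : LSSS (B.p i) n} (ct : Ciphertext B i M) : Data :=
  .ofList [encLSSS M, B.encGT i ct.C, B.encG i ct.C',
    encFam fun l => .cons (B.encG i (ct.Ci l)) (B.encG i (ct.Di l))]

/-! ### Adversaries and games -/

/-- An interactive machine.  In each round it is given its memory and the incoming message, and
outputs its new memory and a request.  `time` is the running time of a round.  `bound` is a
polynomial bound, in the security parameter, on the number of rounds and (see `LegalRun`) on the total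
running time. -/
structure Adversary where
  code : Code
  step : Data → Data
  time : Data → ℕ
  runs : ∀ x, Runs code x (step x) (time x)
  bound : Polynomial ℕ

/-- Requests of an adversary: a random number uniform in `{0, …, m}`, the private key of an attribute
set, the challenge ciphertext, or to stop with a guess. -/
inductive Request (n : ℕ) (Chal : Type) : Type
  | sample (m : ℕ)
  | key (S : Finset (Fin n))
  | challenge (c : Chal)
  | guess (b : Bool)

def Request.enc {Chal : Type} (encChal : Chal → Data) : Request n Chal → Data
  | sample m => .cons (.num 0) (.num m)
  | key S => .cons (.num 1) (encSet S)
  | challenge c => .cons (.num 2) (encChal c)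
  | guess b => .cons (.num 3) (.num (cond b 1 0))

/-- A challenger, after setup and the choice of the bit. -/
structure Challenger (n : ℕ) where
  /-- what the adversary declares in the challenge phase -/
  Chal : Type
  encChal : Chal → Data
  /-- answer to a private key query -/
  keyReply : Finset (Fin n) → PMF Data
  /-- answer to the challenge -/
  chalReply : Chal → PMF Data
  /-- the rules for a declared challenge -/
  Admissible : Chal → Prop
  /-- the attribute sets that satisfy the policy of the challenge -/
  Satisfies : Chal → Finset (Fin n) → Prop

/-- A configuration of the game. -/
structure Config (C : Challenger n) where
  memory : Data
  inbox : Data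
  time : ℕ
  queries : List (Finset (Fin n))
  chal : Option C.Chal
  guess : Option Bool
  /-- set when the adversary sends an ill-formed request or a second challenge -/
  failed : Bool

/-- One round of the game. -/
def playRound (𝒜 : Adversary) (C : Challenger n) (s : Config C) : PMF (Config C) :=
  if s.guess.isSome || s.failed then PMF.pure s else
  let x := Data.cons s.memory s.inbox
  let s' := { s with memory := (𝒜.step x).head, time := s.time + 𝒜.time x }
  match Function.partialInv (Request.enc (n := n) C.encChal) (𝒜.step x).tail with
  | none => PMF.pure { s' with failed := true }
  | some (.sample m) =>
      (PMF.uniformOfFintype (Fin (m + 1))).map fun r => { s' with inbox := .num r.val }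
  | some (.key S) =>
      (C.keyReply S).map fun k => { s' with inbox := k, queries := S :: s.queries }
  | some (.challenge c) =>
      if s.chal.isSome then PMF.pure { s' with failed := true }
      else (C.chalReply c).map fun r => { s' with inbox := r, chal := some c }
  | some (.guess b) => PMF.pure { s' with guess := some b }

/-- The distribution of the configuration after a number of rounds. -/
def playRounds (𝒜 : Adversary) (C : Challenger n) : ℕ → Config C → PMF (Config C)
  | 0, s => PMF.pure s
  | N + 1, s => (playRound 𝒜 C s).bind (playRounds 𝒜 C N)

/-- The game for the security parameter `k`, after setup; the adversary first gets `1^k` and the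
public key. -/
def play (𝒜 : Adversary) (C : Challenger n) (k : ℕ) (pk : Data) : PMF (Config C) :=
  playRounds 𝒜 C (𝒜.bound.eval k)
    { memory := .num 0, inbox := .cons (.unary k) pk, time := 0, queries := [], chal := none,
      guess := none, failed := false }

/-- The adversary followed the rules, and stopped within its time bound: the challenge it declared is
admissible, and no attribute set queried, before or after, satisfies the policy of the challenge.
(An adversary may also stop without declaring a challenge, say because the universe has too few
attributes; its guess is then independent of the bit.) -/
def LegalRun (𝒜 : Adversary) {C : Challenger n} (k : ℕ) (s : Config C) : Prop :=
  s.failed = false ∧ s.guess.isSome ∧ s.time ≤ 𝒜.bound.eval k ∧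
  ∀ c, s.chal = some c → C.Admissible c ∧ ∀ S ∈ s.queries, ¬ C.Satisfies c S

/-- A game: the challenger for each public key, master secret key and bit. -/
abbrev Game (B : BilinearGenerator) (U : ℕ → ℕ) : Type 1 :=
  ∀ (k : ℕ) (i : B.ι), PublicKey B i (U k) → B.G i → Bool → Challenger (U k)

variable {U : ℕ → ℕ}

/-- The adversary is a legal probabilistic polynomial-time adversary in the game. -/
def Legal (𝒢 : Game B U) (𝒜 : Adversary) : Prop :=
  ∀ (k : ℕ), ∀ i ∈ (B.gen k).support, ∀ keys ∈ (setup i (U k)).support, ∀ b,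
  ∀ s ∈ (play 𝒜 (𝒢 k i keys.1 keys.2 b) k (encPK keys.1)).support, LegalRun 𝒜 k s

/-- The experiment that runs the game and outputs whether the guess is right. -/
def experiment (𝒢 : Game B U) (𝒜 : Adversary) (k : ℕ) : PMF Bool :=
  (B.gen k).bind fun i =>
  (setup i (U k)).bind fun keys =>
  (PMF.uniformOfFintype Bool).bind fun b =>
  (play 𝒜 (𝒢 k i keys.1 keys.2 b) k (encPK keys.1)).map fun s => s.guess == some b

/-- `Pr[b' = b] - 1/2`. -/
def advantage (𝒢 : Game B U) (𝒜 : Adversary) (k : ℕ) : ℝ :=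
  (experiment 𝒢 𝒜 k true).toReal - 1 / 2

/-- Every legal probabilistic polynomial-time adversary has at most a negligible advantage. -/
def Secure (𝒢 : Game B U) : Prop :=
  ∀ 𝒜 : Adversary, Legal 𝒢 𝒜 →
    ∃ ν : ℕ → ℝ, Asymptotics.SuperpolynomialDecay Filter.atTop (fun k : ℕ => (k : ℝ)) ν ∧
      ∀ k, advantage 𝒢 𝒜 k ≤ ν k

/-- Challenge declared in the standard game: two messages, and an access structure given by a linear
secret sharing scheme that realizes it. -/
structure Chal₁ (B : BilinearGenerator) (i : B.ι) (n : ℕ) where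
  M₀ : B.GT i
  M₁ : B.GT i
  M : LSSS (B.p i) n

/-- Challenge declared in the contraction game: two messages, an access structure given by an ideal
linear secret sharing scheme that realizes it, and a participant `ψ j`; here `Q = {ψ j}`. -/
structure Chal₂ (B : BilinearGenerator) (i : B.ι) (n : ℕ) where
  M₀ : B.GT i
  M₁ : B.GT i
  M : LSSS (B.p i) n
  ideal : M.Ideal
  j : Fin M.rows

/-- The standard game of Waters' scheme. -/
def G₁ (B : BilinearGenerator) (U : ℕ → ℕ) : Game B U := fun k i pk msk b =>
  { Chal := Chal₁ B i (U k)
    encChal := fun c => .ofList [B.encGT i c.M₀, B.encGT i c.M₁, encLSSS c.M]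
    keyReply := fun S => (keyGen pk msk S).map encSK
    chalReply := fun c => (encrypt pk (if b then c.M₁ else c.M₀) c.M).map encCT
    Admissible := fun c => (B.encGT i c.M₀).size = (B.encGT i c.M₁).size
    Satisfies := fun c S => S ∩ c.M.participants ∈ c.M.access }

/-- The contraction game of the scheme with contractions; the challenge is answered with the
ciphertext, the contracted ciphertext and the restricted contraction key. -/
def G₂ (B : BilinearGenerator) (U : ℕ → ℕ) : Game B U := fun k i pk msk b =>
  { Chal := Chal₂ B i (U k)
    encChal := fun c =>
      .ofList [B.encGT i c.M₀, B.encGT i c.M₁, encLSSS c.M, encAttr (c.M.ψ c.j)]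
    keyReply := fun S => (keyGen pk msk S).map encSK
    chalReply := fun c => (encryptStar pk (if b then c.M₁ else c.M₀) c.M).map fun x =>
      .ofList [encCT x.1, encCT (contractCT pk x.1 c.j (x.2 c.j)), encZ (x.2 c.j)]
    Admissible := fun c => (B.encGT i c.M₀).size = (B.encGT i c.M₁).size ∧
      c.M.Connected ∧ {c.M.ψ c.j} ∉ c.M.access
    Satisfies := fun c S =>
      S ∩ (c.M.participants \ {c.M.ψ c.j}) ∈ contraction c.M.access {c.M.ψ c.j} }

end CPABE

end

noncomputable section

namespace CPABE

/-! ### Elementary facts on data and running times -/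

namespace Data

/-! The reduction is tight: from an adversary in the contraction game one builds an adversary in
Waters' game with exactly the same advantage. Let `k` be the pivot column of row `j`. Contraction
eliminates column `k` from the other rows, so the shares under the contracted policy do not depend
on the entry `v_k`. As `h_{jk} ≠ 0`, that entry can be moved to give row `j` any prescribed share
`w`, and as `k` is not the first column, the secret `s` stays the same. Since `h_l · v = h'_l · v +
w h_{lk} / h_{jk}`, a ciphertext under `M` can be rebuilt from one under the contraction with the
public key and two random exponents: the share `w` and the exponent `ρ` of row `j`. If these are
uniform, the rebuilt ciphertext, the given one and `ρ` are jointly distributed as in the contraction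
game (`reconstruct_distribution`). The pivot exists because the policy is connected and `{ψ j}` is
unauthorized (`LSSS.pivot_spec`).

Private key queries are passed on unchanged. They stay legal because a set authorized for the
contracted matrix is authorized in the contracted access structure (`LSSS.mem_contraction`).

The rest makes this precise. The predicate `Cmp` says that one program, halting everywhere, computes
a family of outputs within a polynomial bound; its closure properties yield the program of the
reduction (`exists_reduction`), specified only on the inputs that occur. The exponents `w` and `ρ`
are drawn at the start, but the simulated adversary sees nothing of them before the challenge. The
induction `faithful` therefore compares one run of the contraction game with a whole family of runs
of the standard game, until the challenge merges the exponents into the reply. -/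

theorem size_pos (x : Data) : 0 < x.size := by cases x <;> simp [size]

theorem size_head_le (x : Data) : x.head.size ≤ x.size := by
  cases x <;> simp [head, size]; omega

theorem size_tail_le (x : Data) : x.tail.size ≤ x.size := by
  cases x <;> simp [tail, size]; omega

theorem size_val_lt (x : Data) : Nat.size x.val < x.size := by
  cases x <;> simp [val, size]

theorem size_num_le {a b : ℕ} (h : a ≤ b) : (num a).size ≤ (num b).size := by
  simp [size, Nat.size_le_size h]

end Data

open Data

/-- All results lie below `2 ^ x.size`, since the bits of a product are at most those of both
factors together. Charging an instruction for its input thus pays for its output as well. -/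
theorem Op.size_apply_le (o : Op) (x : Data) : (o.apply x).size ≤ 1 + x.size := by
  have key : ∀ m : ℕ, m < 2 ^ x.size → (num m).size ≤ 1 + x.size := fun m hm => by
    have := Nat.size_le.2 hm
    simp only [size]; omega
  cases x with
  | num n => cases o <;> simp [apply, head, tail, val, size]
  | cons u v =>
    have ha : u.val < 2 ^ u.size := Nat.size_le.1 (size_val_lt u).le
    have hb : v.val < 2 ^ v.size := Nat.size_le.1 (size_val_lt v).le
    have hpu : 2 ^ u.size ≤ 2 ^ (u.size + v.size + 1) := Nat.pow_le_pow_right two_pos (by omega)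
    have hpv : 2 ^ v.size ≤ 2 ^ (u.size + v.size) := Nat.pow_le_pow_right two_pos (by omega)
    have hpu' : 2 ^ u.size ≤ 2 ^ (u.size + v.size) := Nat.pow_le_pow_right two_pos (by omega)
    have hs : (2 : ℕ) ^ (u.size + v.size + 1) = 2 ^ (u.size + v.size) * 2 := pow_succ ..
    have hm : u.val * v.val < 2 ^ (u.size + v.size) := by
      rw [pow_add]; exact Nat.mul_lt_mul'' ha hb
    have h1 := Nat.div_le_self u.val v.val
    have h2 := Nat.mod_le u.val v.val
    cases o <;> refine key _ ?_ <;> simp only [head, tail, size] <;> omega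

/-- Time bounds are also length bounds, both for what is read and for what is written. This is why
no separate length estimates are needed when programs are composed. -/
theorem Runs.size_lt {c x y t} (h : Runs c x y t) : x.size < t ∧ y.size ≤ t := by
  induction h with
  | id x => omega
  | lit n x => simp only [size]; have := size_pos x; omega
  | fst x => have := size_head_le x; omega
  | snd x => have := size_tail_le x; omega
  | isLeaf x => have := size_pos x; cases x <;> simp [Data.isLeaf, size] at *; omega
  | op o x => have := o.size_apply_le x; omega
  | pair _ _ h1 h2 => simp only [size]; omega
  | comp _ _ h1 h2 => omega
  | iteTrue _ _ _ h1 h2 => omega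
  | iteFalse _ _ _ h1 h2 => omega
  | @loopStop f x y s _ _ h1 => have := size_tail_le y; omega
  | loopNext _ _ _ h1 h2 => omega

/-- Determinism identifies the output that totality provides with the one prescribed on a family of
inputs. -/
theorem Runs.unique {c x y t} (h : Runs c x y t) : ∀ {y' t'}, Runs c x y' t' → y = y' ∧ t = t' := by
  induction h with
  | id x => intro y' t' h; cases h; simp
  | lit n x => intro y' t' h; cases h; simp
  | fst x => intro y' t' h; cases h; simp
  | snd x => intro y' t' h; cases h; simp
  | isLeaf x => intro y' t' h; cases h; simp
  | op o x => intro y' t' h; cases h; simp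
  | pair _ _ h1 h2 =>
    intro y' t' h; cases h with
    | pair a b => obtain ⟨rfl, rfl⟩ := h1 a; obtain ⟨rfl, rfl⟩ := h2 b; simp
  | comp _ _ h1 h2 =>
    intro y' t' h; cases h with
    | comp a b => obtain ⟨rfl, rfl⟩ := h1 a; obtain ⟨rfl, rfl⟩ := h2 b; simp
  | iteTrue _ hy _ h1 h2 =>
    intro y' t' h; cases h with
    | iteTrue a _ b => obtain ⟨rfl, rfl⟩ := h1 a; obtain ⟨rfl, rfl⟩ := h2 b; simp
    | iteFalse a hy' b => exact absurd ((h1 a).1.trans hy') hy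
  | iteFalse _ hy _ h1 h2 =>
    intro y' t' h; cases h with
    | iteTrue a hy' b => exact absurd ((h1 a).1.symm.trans hy) hy'
    | iteFalse a _ b => obtain ⟨rfl, rfl⟩ := h1 a; obtain ⟨rfl, rfl⟩ := h2 b; simp
  | loopStop _ hy h1 =>
    intro y' t' h; cases h with
    | loopStop a _ => obtain ⟨rfl, rfl⟩ := h1 a; simp
    | loopNext a hy' b => obtain ⟨rfl, -⟩ := h1 a; exact absurd hy hy'
  | loopNext _ hy _ h1 h2 =>
    intro y' t' h; cases h with
    | loopStop a hy' => obtain ⟨rfl, -⟩ := h1 a; exact absurd hy' hy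
    | loopNext a _ b => obtain ⟨rfl, rfl⟩ := h1 a; obtain ⟨rfl, rfl⟩ := h2 b; simp

theorem polynomial_eval_mono (q : Polynomial ℕ) : Monotone fun n : ℕ => q.eval n := by
  intro a b h
  simp only [Polynomial.eval_eq_sum]
  exact Finset.sum_le_sum fun i _ => Nat.mul_le_mul_left _ (Nat.pow_le_pow_left h i)

/-! ### Polynomially bounded families -/

/-- `f` is bounded by a polynomial in `K`. -/
def PolyBdd {ι : Type} (K f : ι → ℕ) : Prop := ∃ q : Polynomial ℕ, ∀ a, f a ≤ q.eval (K a)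

namespace PolyBdd

variable {ι ι' : Type} {K f g : ι → ℕ}

theorem self : PolyBdd K K := ⟨Polynomial.X, fun a => by simp⟩

theorem const (n : ℕ) : PolyBdd K fun _ => n := ⟨Polynomial.C n, fun a => by simp⟩

theorem mono (hf : PolyBdd K f) (h : ∀ a, g a ≤ f a) : PolyBdd K g :=
  hf.imp fun _ hq a => (h a).trans (hq a)

theorem of_le (h : ∀ a, g a ≤ K a) : PolyBdd K g := self.mono h

theorem add (hf : PolyBdd K f) (hg : PolyBdd K g) : PolyBdd K fun a => f a + g a := by
  obtain ⟨q, hq⟩ := hf; obtain ⟨r, hr⟩ := hg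
  exact ⟨q + r, fun a => by simpa using Nat.add_le_add (hq a) (hr a)⟩

theorem mul (hf : PolyBdd K f) (hg : PolyBdd K g) : PolyBdd K fun a => f a * g a := by
  obtain ⟨q, hq⟩ := hf; obtain ⟨r, hr⟩ := hg
  exact ⟨q * r, fun a => by simpa using Nat.mul_le_mul (hq a) (hr a)⟩

theorem eval (q : Polynomial ℕ) (hf : PolyBdd K f) : PolyBdd K fun a => q.eval (f a) := by
  obtain ⟨r, hr⟩ := hf
  exact ⟨q.comp r, fun a => by simpa using polynomial_eval_mono q (hr a)⟩

theorem trans {K' : ι → ℕ} (hf : PolyBdd K f) (hK : PolyBdd K' K) : PolyBdd K' f := by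
  obtain ⟨q, hq⟩ := hf
  exact (eval q hK).mono hq

theorem reindex (hf : PolyBdd K f) (φ : ι' → ι) : PolyBdd (fun b => K (φ b)) fun b => f (φ b) :=
  hf.imp fun _ hq b => hq (φ b)

end PolyBdd

/-! ### Computability in polynomial time over families of inputs -/

/-- The program halts on all inputs. -/
def Total (c : Code) : Prop := ∀ x, ∃ y t, Runs c x y t

/-- The program `c` computes `Y a` from `X a` in time polynomial in `K a`. -/
def ComputedBy {ι : Type} (c : Code) (K : ι → ℕ) (X Y : ι → Data) : Prop :=
  ∃ t : ι → ℕ, (∀ a, Runs c (X a) (Y a) (t a)) ∧ PolyBdd K t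

/-- A program that always halts computes `Y a` from `X a` in time polynomial in `K a`. -/
def Cmp {ι : Type} (K : ι → ℕ) (X Y : ι → Data) : Prop := ∃ c, Total c ∧ ComputedBy c K X Y

namespace ComputedBy

variable {ι ι' : Type} {K : ι → ℕ} {X Y Z : ι → Data} {c f g : Code}

theorem left (h : ComputedBy c K X Y) : PolyBdd K fun a => (X a).size := by
  obtain ⟨t, h, ht⟩ := h
  exact ht.mono fun a => (h a).size_lt.1.le

theorem right (h : ComputedBy c K X Y) : PolyBdd K fun a => (Y a).size := by
  obtain ⟨t, h, ht⟩ := h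
  exact ht.mono fun a => (h a).size_lt.2

theorem unit (h : PolyBdd K fun a => (X a).size) : PolyBdd K fun a => 1 + (X a).size :=
  (PolyBdd.const 1).add h

theorem id (h : PolyBdd K fun a => (X a).size) : ComputedBy .id K X X :=
  ⟨_, fun _ => .id _, unit h⟩

theorem fst (h : PolyBdd K fun a => (X a).size) : ComputedBy .fst K X fun a => (X a).head :=
  ⟨_, fun _ => .fst _, unit h⟩

theorem snd (h : PolyBdd K fun a => (X a).size) : ComputedBy .snd K X fun a => (X a).tail :=
  ⟨_, fun _ => .snd _, unit h⟩

theorem isLeaf (h : PolyBdd K fun a => (X a).size) :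
    ComputedBy .isLeaf K X fun a => (X a).isLeaf :=
  ⟨_, fun _ => .isLeaf _, unit h⟩

theorem op (o : Op) (h : PolyBdd K fun a => (X a).size) :
    ComputedBy (.op o) K X fun a => o.apply (X a) :=
  ⟨_, fun _ => .op _ _, unit h⟩

theorem lit (n : ℕ) (h : PolyBdd K fun a => (X a).size) :
    ComputedBy (.lit n) K X fun _ => num n :=
  ⟨_, fun _ => .lit _ _, (unit h).add (.const _)⟩

theorem pair (hf : ComputedBy f K X Y) (hg : ComputedBy g K X Z) :
    ComputedBy (.pair f g) K X fun a => cons (Y a) (Z a) := by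
  obtain ⟨s, h1, hs⟩ := hf; obtain ⟨t, h2, ht⟩ := hg
  exact ⟨_, fun a => .pair (h1 a) (h2 a), ((PolyBdd.const 1).add hs).add ht⟩

theorem comp (hg : ComputedBy g K Y Z) (hf : ComputedBy f K X Y) :
    ComputedBy (.comp g f) K X Z := by
  obtain ⟨s, h1, hs⟩ := hf; obtain ⟨t, h2, ht⟩ := hg
  exact ⟨_, fun a => .comp (h1 a) (h2 a), ((PolyBdd.const 1).add hs).add ht⟩

theorem iteTrue {W : ι → Data} (hc : ComputedBy c K X W) (hW : ∀ a, W a ≠ num 0)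
    (hf : ComputedBy f K X Y) : ComputedBy (.ite c f g) K X Y := by
  obtain ⟨s, h1, hs⟩ := hc; obtain ⟨t, h2, ht⟩ := hf
  exact ⟨_, fun a => .iteTrue (h1 a) (hW a) (h2 a), ((PolyBdd.const 1).add hs).add ht⟩

theorem iteFalse {W : ι → Data} (hc : ComputedBy c K X W) (hW : ∀ a, W a = num 0)
    (hg : ComputedBy g K X Y) : ComputedBy (.ite c f g) K X Y := by
  obtain ⟨s, h1, hs⟩ := hc; obtain ⟨t, h2, ht⟩ := hg
  exact ⟨_, fun a => .iteFalse (h1 a) (hW a) (h2 a), ((PolyBdd.const 1).add hs).add ht⟩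

theorem reindex (h : ComputedBy c K X Y) (φ : ι' → ι) :
    ComputedBy c (fun b => K (φ b)) (fun b => X (φ b)) fun b => Y (φ b) := by
  obtain ⟨t, h, ht⟩ := h
  exact ⟨_, fun b => h (φ b), ht.reindex φ⟩

/-- A family of runs that is covered by another one. -/
theorem of_exists {K' : ι' → ℕ} {X' Y' : ι' → Data} (h : ComputedBy c K X Y)
    (hφ : ∀ b, ∃ a, K a = K' b ∧ X a = X' b ∧ Y a = Y' b) : ComputedBy c K' X' Y' := by
  choose φ h1 h2 h3 using hφ
  have := h.reindex φ
  simpa only [h1, h2, h3] using this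

end ComputedBy

namespace Total

variable {c f g : Code}

theorem id : Total .id := fun _ => ⟨_, _, .id _⟩
theorem lit (n : ℕ) : Total (.lit n) := fun _ => ⟨_, _, .lit _ _⟩
theorem fst : Total .fst := fun _ => ⟨_, _, .fst _⟩
theorem snd : Total .snd := fun _ => ⟨_, _, .snd _⟩
theorem isLeaf : Total .isLeaf := fun _ => ⟨_, _, .isLeaf _⟩
theorem op (o : Op) : Total (.op o) := fun _ => ⟨_, _, .op _ _⟩

theorem pair (hf : Total f) (hg : Total g) : Total (.pair f g) := fun x => by
  obtain ⟨_, _, h1⟩ := hf x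
  obtain ⟨_, _, h2⟩ := hg x
  exact ⟨_, _, .pair h1 h2⟩

theorem comp (hg : Total g) (hf : Total f) : Total (.comp g f) := fun x => by
  obtain ⟨y, _, h1⟩ := hf x
  obtain ⟨_, _, h2⟩ := hg y
  exact ⟨_, _, .comp h1 h2⟩

theorem ite (hc : Total c) (hf : Total f) (hg : Total g) : Total (.ite c f g) := fun x => by
  obtain ⟨y, _, h1⟩ := hc x
  obtain ⟨_, _, h2⟩ := hf x
  obtain ⟨_, _, h3⟩ := hg x
  by_cases hy : y = num 0
  · exact ⟨_, _, .iteFalse h1 hy h3⟩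
  · exact ⟨_, _, .iteTrue h1 hy h2⟩

theorem loop (μ : Data → ℕ)
    (h : ∀ x, ∃ y t, Runs f x y t ∧ (y.head ≠ num 0 → μ y.tail < μ x)) : Total (.loop f) := by
  intro x
  induction hn : μ x using Nat.strong_induction_on generalizing x with
  | _ n ih =>
    obtain ⟨y, t, h1, h2⟩ := h x
    by_cases hy : y.head = num 0
    · exact ⟨_, _, .loopStop h1 hy⟩
    · obtain ⟨z, s, h3⟩ := ih _ (hn ▸ h2 hy) y.tail rfl
      exact ⟨_, _, .loopNext h1 hy h3⟩

end Total

/-- Each of the `l + 1` executions of the body costs at most `T`, plus one unit for the loop; the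
induction shifts the sequence of states. -/
theorem Runs.loop {f : Code} (T : ℕ) {y : Data} : ∀ (l : ℕ) {S : ℕ → Data},
    (∀ m < l, ∃ b t, b ≠ num 0 ∧ t ≤ T ∧ Runs f (S m) (cons b (S (m + 1))) t) →
    (∃ t ≤ T, Runs f (S l) (cons (num 0) y) t) →
    ∃ t ≤ (l + 1) * (T + 1), Runs (.loop f) (S 0) y t
  | 0, S, _, ⟨t, ht, h⟩ => ⟨1 + t, by omega, .loopStop h rfl⟩
  | l + 1, S, hs, hl => by
    obtain ⟨t, ht, h⟩ := Runs.loop T l (S := fun m => S (m + 1))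
      (fun m hm => hs (m + 1) (by omega)) hl
    obtain ⟨b, s, hb, hs, h'⟩ := hs 0 (by omega)
    refine ⟨1 + s + t, ?_, .loopNext h' hb h⟩
    rw [add_mul (l + 1)]; omega

namespace ComputedBy

/-- Iteration of a program over states indexed by the number of rounds. -/
theorem loop {ι : Type} {K l : ι → ℕ} {f : Code} {S : ι → ℕ → Data} {Y : ι → Data}
    (hl : PolyBdd K l)
    (hnext : ComputedBy f (fun z : Σ a, Fin (l a) => K z.1) (fun z => S z.1 z.2)
      fun z => cons (num 1) (S z.1 (z.2 + 1)))
    (hlast : ComputedBy f K (fun a => S a (l a)) fun a => cons (num 0) (Y a)) :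
    ComputedBy (.loop f) K (fun a => S a 0) Y := by
  obtain ⟨t, h1, q, hq⟩ := hnext
  obtain ⟨s, h2, r, hr⟩ := hlast
  have key : ∀ a, ∃ τ ≤ (l a + 1) * (q.eval (K a) + r.eval (K a) + 1),
      Runs (.loop f) (S a 0) (Y a) τ := fun a =>
    Runs.loop _ (l a)
      (fun m hm => ⟨_, _, by simp, (hq ⟨a, m, hm⟩).trans (Nat.le_add_right _ _), h1 ⟨a, m, hm⟩⟩)
      ⟨_, (hr a).trans (Nat.le_add_left _ _), h2 a⟩
  choose τ hτ h using key
  exact ⟨τ, h, ((hl.add (.const 1)).mul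
    (((PolyBdd.self.eval q).add (PolyBdd.self.eval r)).add (.const 1))).mono hτ⟩

end ComputedBy

namespace Cmp

variable {ι ι' : Type} {K : ι → ℕ} {X Y Z : ι → Data}

theorem left (h : Cmp K X Y) : PolyBdd K fun a => (X a).size := h.choose_spec.2.left

theorem right (h : Cmp K X Y) : PolyBdd K fun a => (Y a).size := h.choose_spec.2.right

theorem refl (h : PolyBdd K fun a => (X a).size) : Cmp K X X := ⟨_, .id, .id h⟩

theorem trans (h1 : Cmp K X Y) (h2 : Cmp K Y Z) : Cmp K X Z := by
  obtain ⟨f, hf, h1⟩ := h1; obtain ⟨g, hg, h2⟩ := h2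
  exact ⟨_, hg.comp hf, h2.comp h1⟩

theorem head (h : Cmp K X Y) : Cmp K X fun a => (Y a).head :=
  h.trans ⟨_, .fst, .fst h.right⟩

theorem tail (h : Cmp K X Y) : Cmp K X fun a => (Y a).tail :=
  h.trans ⟨_, .snd, .snd h.right⟩

theorem isLeaf (h : Cmp K X Y) : Cmp K X fun a => (Y a).isLeaf :=
  h.trans ⟨_, .isLeaf, .isLeaf h.right⟩

theorem cons (h1 : Cmp K X Y) (h2 : Cmp K X Z) : Cmp K X fun a => cons (Y a) (Z a) := by
  obtain ⟨f, hf, h1⟩ := h1; obtain ⟨g, hg, h2⟩ := h2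
  exact ⟨_, hf.pair hg, h1.pair h2⟩

theorem lit (h : PolyBdd K fun a => (X a).size) (n : ℕ) : Cmp K X fun _ => num n :=
  ⟨_, .lit n, .lit n h⟩

theorem op (o : Op) (h : Cmp K X Y) : Cmp K X fun a => o.apply (Y a) :=
  h.trans ⟨_, .op o, .op o h.right⟩

section arith

variable {u v : ι → ℕ} (hu : Cmp K X fun a => num (u a)) (hv : Cmp K X fun a => num (v a))
include hu hv

theorem add : Cmp K X fun a => num (u a + v a) := (hu.cons hv).op .add
theorem sub : Cmp K X fun a => num (u a - v a) := (hu.cons hv).op .sub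
theorem mul : Cmp K X fun a => num (u a * v a) := (hu.cons hv).op .mul
theorem div : Cmp K X fun a => num (u a / v a) := (hu.cons hv).op .div
theorem mod : Cmp K X fun a => num (u a % v a) := (hu.cons hv).op .mod

end arith

theorem reindex (h : Cmp K X Y) (φ : ι' → ι) :
    Cmp (fun b => K (φ b)) (fun b => X (φ b)) fun b => Y (φ b) := by
  obtain ⟨c, hc, h⟩ := h
  exact ⟨c, hc, h.reindex φ⟩

theorem of_exists {K' : ι' → ℕ} {X' Y' : ι' → Data} (h : Cmp K X Y)
    (hφ : ∀ b, ∃ a, K a = K' b ∧ X a = X' b ∧ Y a = Y' b) : Cmp K' X' Y' := by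
  obtain ⟨c, hc, h⟩ := h
  exact ⟨c, hc, h.of_exists hφ⟩

theorem congr (h : Cmp K X Y) (e : ∀ a, Y a = Z a) : Cmp K X Z := by
  rwa [funext e] at h

/-- Definition by cases. -/
theorem cases {W : ι → Data} (hW : Cmp K X W)
    (h1 : Cmp (fun z : {a // W a ≠ num 0} => K z) (fun z => X z) fun z => Y z)
    (h0 : Cmp (fun z : {a // W a = num 0} => K z) (fun z => X z) fun z => Y z) : Cmp K X Y := by
  obtain ⟨c, hc, hW⟩ := hW
  obtain ⟨f, hf, h1⟩ := h1
  obtain ⟨g, hg, h0⟩ := h0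
  -- Each branch is only required to be correct on its own subfamily; there the other branch is
  -- never entered.
  have h1' := ComputedBy.iteTrue (g := g) (hW.reindex fun z : {a // W a ≠ num 0} => z.1)
    (fun z => z.2) h1
  have h0' := ComputedBy.iteFalse (f := f) (hW.reindex fun z : {a // W a = num 0} => z.1)
    (fun z => z.2) h0
  refine ⟨_, hc.ite hf hg, ?_⟩
  obtain ⟨t1, r1, q1, b1⟩ := h1'
  obtain ⟨t0, r0, q0, b0⟩ := h0'
  have key : ∀ a, ∃ t ≤ q1.eval (K a) + q0.eval (K a), Runs (.ite c f g) (X a) (Y a) t := by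
    intro a
    by_cases h : W a = num 0
    · exact ⟨_, (b0 ⟨a, h⟩).trans (Nat.le_add_left _ _), r0 ⟨a, h⟩⟩
    · exact ⟨_, (b1 ⟨a, h⟩).trans (Nat.le_add_right _ _), r1 ⟨a, h⟩⟩
  choose t ht h using key
  exact ⟨t, h, ((PolyBdd.self.eval q1).add (PolyBdd.self.eval q0)).mono ht⟩

theorem ite {c : ι → ℕ} (hc : Cmp K X fun a => num (c a)) (hY : Cmp K X Y) (hZ : Cmp K X Z)
    {p : ι → Prop} [DecidablePred p] (hp : ∀ a, p a ↔ c a ≠ 0) :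
    Cmp K X fun a => if p a then Y a else Z a := by
  refine cases hc ((hY.reindex _).congr fun z => ?_) ((hZ.reindex _).congr fun z => ?_)
  · rw [if_pos ((hp _).2 fun h => z.2 (by rw [h]))]
  · rw [if_neg fun h => (hp _).1 h (by simpa using z.2)]

theorem ite_num {c u v : ι → ℕ} (hc : Cmp K X fun a => num (c a))
    (hu : Cmp K X fun a => num (u a)) (hv : Cmp K X fun a => num (v a))
    {p : ι → Prop} [DecidablePred p] (hp : ∀ a, p a ↔ c a ≠ 0) :
    Cmp K X fun a => num (if p a then u a else v a) :=
  (hc.ite hu hv hp).congr fun a => (apply_ite num (p a) (u a) (v a)).symm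

end Cmp

/-! ### Loops -/

/-- Body of a counting loop; states are `cons n (cons x acc)`. -/
def forBody (b : Code) : Code :=
  -- Adding `0` turns the counter into a leaf, an inner node counting as `0`. The value of the
  -- counter then measures termination on arbitrary data.
  .ite (.comp (.op .add) (.pair .fst (.lit 0)))
    (.pair (.lit 1) (.pair (.comp (.op .sub) (.pair .fst (.lit 1)))
      (.pair (.comp .fst .snd)
        (.comp b (.pair (.comp (.op .sub) (.pair .fst (.lit 1))) .snd)))))
    (.pair (.lit 0) (.comp .snd .snd))

section forLoop

variable {ι : Type} {K : ι → ℕ} {S Z : ι → Data} {b : Code}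

theorem ComputedBy.forBody_next (h0 : ∀ a, (S a).head.val ≠ 0)
    (hb : ComputedBy b K (fun a => cons (num ((S a).head.val - 1)) (S a).tail) Z)
    (hS : PolyBdd K fun a => (S a).size) :
    ComputedBy (forBody b) K S
      fun a => cons (num 1) (cons (num ((S a).head.val - 1)) (cons (S a).tail.head (Z a))) := by
  have hd : ComputedBy (.comp (.op .sub) (.pair .fst (.lit 1))) K S
      fun a => num ((S a).head.val - 1) :=
    let h := (ComputedBy.fst hS).pair (.lit 1 hS)
    (ComputedBy.op .sub h.right).comp h
  have ht : ComputedBy (.comp (.op .add) (.pair .fst (.lit 0))) K S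
      fun a => num ((S a).head.val + 0) :=
    let h := (ComputedBy.fst hS).pair (.lit 0 hS)
    (ComputedBy.op .add h.right).comp h
  have hs := ComputedBy.snd hS
  exact .iteTrue ht (fun a => by simpa using h0 a) ((ComputedBy.lit 1 hS).pair (hd.pair
    (((ComputedBy.fst hs.right).comp hs).pair (hb.comp (hd.pair hs)))))

theorem ComputedBy.forBody_halt (h0 : ∀ a, (S a).head.val = 0)
    (hS : PolyBdd K fun a => (S a).size) :
    ComputedBy (forBody b) K S fun a => Data.cons (num 0) (S a).tail.tail := by
  have ht : ComputedBy (.comp (.op .add) (.pair .fst (.lit 0))) K S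
      fun a => num ((S a).head.val + 0) :=
    let h := (ComputedBy.fst hS).pair (.lit 0 hS)
    (ComputedBy.op .add h.right).comp h
  have hs := ComputedBy.snd hS
  exact .iteFalse ht (fun a => by simpa using h0 a) ((ComputedBy.lit 0 hS).pair
    ((ComputedBy.snd hs.right).comp hs))

theorem Total.forLoop (hb : Total b) : Total (.loop (forBody b)) := by
  refine Total.loop (fun x => x.head.val) fun x => ?_
  by_cases h0 : x.head.val = 0
  -- A one-element index type makes the statement on families one about the single input `x`.
  · obtain ⟨t, h, -⟩ := ComputedBy.forBody_halt (ι := Unit) (K := fun _ => x.size)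
      (S := fun _ => x) (b := b) (fun _ => h0) .self
    exact ⟨_, _, h (), by simp [head]⟩
  · obtain ⟨y, s, hy⟩ := hb (cons (num (x.head.val - 1)) x.tail)
    obtain ⟨t, h, -⟩ := ComputedBy.forBody_next (ι := Unit) (K := fun _ => x.size + s)
      (S := fun _ => x) (b := b) (Z := fun _ => y) (fun _ => h0)
      ⟨fun _ => s, fun _ => hy, .of_le fun _ => Nat.le_add_left _ _⟩
      (.of_le fun _ => Nat.le_add_right _ _)
    refine ⟨_, _, h (), fun _ => ?_⟩
    show x.head.val - 1 < x.head.val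
    omega

end forLoop

namespace Cmp

variable {ι : Type} {K : ι → ℕ} {X Y : ι → Data}

/-- A loop that counts down from `l a`; `A a n` is the accumulator when the counter is `n`.
The body has access to everything that can be computed from the input of the loop. -/
theorem forLoop {l : ι → ℕ} {A : ι → ℕ → Data} (hl : Cmp K X fun a => num (l a))
    (hlb : PolyBdd K l)
    (hA : PolyBdd (fun z : Σ a, Fin (l a + 1) => K z.1) fun z => (A z.1 z.2).size)
    (hinit : Cmp K X fun a => A a (l a))
    (hstep : ∀ X' : (Σ a, Fin (l a)) → Data,
      (∀ Y : ι → Data, Cmp K X Y → Cmp (fun z => K z.1) X' fun z => Y z.1) →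
      Cmp (fun z => K z.1) X' (fun z => num z.2) →
      Cmp (fun z => K z.1) X' (fun z => A z.1 (z.2 + 1)) →
      Cmp (fun z => K z.1) X' fun z => A z.1 z.2) :
    Cmp K X fun a => A a 0 := by
  have hX : PolyBdd (fun z : Σ a, Fin (l a) => K z.1) fun z => (X z.1).size :=
    hl.left.reindex fun z : (Σ a, Fin (l a)) => z.1
  have hn : PolyBdd (fun z : Σ a, Fin (l a) => K z.1) fun z => (num z.2).size :=
    (hl.right.reindex fun z : (Σ a, Fin (l a)) => z.1).mono fun z => size_num_le z.2.2.le
  have hA' : PolyBdd (fun z : Σ a, Fin (l a) => K z.1) fun z => (A z.1 (z.2 + 1)).size :=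
    hA.reindex fun z : (Σ a, Fin (l a)) => ⟨z.1, z.2.succ⟩
  have hS : PolyBdd (fun z : Σ a, Fin (l a) => K z.1)
      fun z => (Data.cons (num z.2) (.cons (X z.1) (A z.1 (z.2 + 1)))).size :=
    ((hn.add ((hX.add hA').add (.const 1))).add (.const 1))
  have r := Cmp.refl hS
  -- The abstract input `X'` becomes the loop state: counter, original input and accumulator are
  -- projections of it.
  obtain ⟨b, hb, hbc⟩ := hstep _ (fun Y hY => r.tail.head.trans
    (hY.reindex fun z : (Σ a, Fin (l a)) => z.1)) r.head r.tail.tail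
  have hstart := hl.cons ((Cmp.refl hl.left).cons hinit)
  refine hstart.trans ⟨.loop (forBody b), hb.forLoop, ?_⟩
  have key := ComputedBy.loop (K := K) (l := l) (f := forBody b)
    (S := fun a m => Data.cons (num (l a - m)) (.cons (X a) (A a (l a - m))))
    (Y := fun a => A a 0) hlb ?_ ?_
  · simpa using key
  · have hS' : PolyBdd (fun z : Σ a, Fin (l a) => K z.1) fun z =>
        (Data.cons (num (z.2 + 1)) (.cons (X z.1) (A z.1 (z.2 + 1)))).size :=
      (((hl.right.reindex fun z : (Σ a, Fin (l a)) => z.1).mono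
        fun z => size_num_le (b := l z.1) z.2.2).add ((hX.add hA').add (.const 1))).add (.const 1)
    have := ComputedBy.forBody_next (b := b)
      (S := fun z : Σ a, Fin (l a) => Data.cons (num (z.2 + 1)) (.cons (X z.1) (A z.1 (z.2 + 1))))
      (Z := fun z => A z.1 z.2) (by simp [Data.head, val])
      (by simpa [Data.head, val, Data.tail] using hbc) hS'
    -- Rounds are numbered upwards while the counter runs down, hence the reversal.
    refine this.of_exists fun z => ⟨⟨z.1, z.2.rev⟩, rfl, ?_, ?_⟩
    · have : (z.2.rev : ℕ) + 1 = l z.1 - z.2 := by simp [Fin.rev]; omega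
      simp only [this]
    · have : (z.2.rev : ℕ) = l z.1 - (z.2 + 1) := by simp [Fin.rev]
      simp only [Data.head, val, Data.tail, this, Nat.add_sub_cancel]
  · have := ComputedBy.forBody_halt (b := b) (K := K)
      (S := fun a => Data.cons (num 0) (.cons (X a) (A a 0))) (by simp [Data.head, val])
      (((PolyBdd.const _).add ((hl.left.add
        (hA.reindex fun a => ⟨a, 0⟩)).add (.const 1))).add (.const 1))
    simpa [Data.tail] using this

end Cmp

namespace Data

@[simp] theorem head_cons (x y : Data) : (cons x y).head = x := rfl
@[simp] theorem tail_cons (x y : Data) : (cons x y).tail = y := rfl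
@[simp] theorem val_num (n : ℕ) : (num n).val = n := rfl
@[simp] theorem isLeaf_num (n : ℕ) : (num n).isLeaf = num 1 := rfl
@[simp] theorem isLeaf_cons (x y : Data) : (cons x y).isLeaf = num 0 := rfl

end Data

/-! ### Lists -/

theorem Data.length_le_size_ofList : ∀ xs : List Data, xs.length ≤ (ofList xs).size
  | [] => by simp
  | x :: xs => by
    have := length_le_size_ofList xs
    simp only [ofList, size, List.length_cons]; omega

theorem Data.size_ofList_le {B : ℕ} : ∀ {xs : List Data}, (∀ x ∈ xs, x.size ≤ B) →
    (ofList xs).size ≤ xs.length * (B + 1) + 1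
  | [], _ => by simp [ofList, size]
  | x :: xs, h => by
    have h1 := size_ofList_le (xs := xs) fun y hy => h y (by simp [hy])
    have h2 := h x (by simp)
    simp only [ofList, size, List.length_cons, add_mul]; omega

theorem Data.tail_iterate_ofList (xs : List Data) (m : ℕ) :
    tail^[m] (ofList xs) = ofList (xs.drop m) := by
  induction m generalizing xs with
  | zero => simp
  | succ m ih =>
    cases xs with
    | nil => simpa [ofList, tail] using ih []
    | cons x xs => simpa [ofList, tail] using ih xs

theorem Data.size_tail_iterate_le (x : Data) (m : ℕ) : (tail^[m] x).size ≤ x.size := by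
  induction m with
  | zero => simp
  | succ m ih => rw [Function.iterate_succ_apply']; exact (size_tail_le _).trans ih

theorem Data.head_drop_ofFn {l : ℕ} (f : Fin l → Data) (n : Fin l) :
    (ofList ((List.ofFn f).drop n)).head = f n := by
  rw [List.drop_eq_getElem_cons (by simp)]
  simp [ofList, head]

theorem le_size_encFam {l : ℕ} (f : Fin l → Data) : l ≤ (encFam f).size := by
  simpa [encFam] using length_le_size_ofList (List.ofFn f)

/-- Whatever is computable from `X` is computable from `X'`, uniformly along `φ`. -/
abbrev Lifts {ι κ : Type} (K : ι → ℕ) (X : ι → Data) (φ : κ → ι) (X' : κ → Data) : Prop :=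
  ∀ Y : ι → Data, Cmp K X Y → Cmp (fun z => K (φ z)) X' fun z => Y (φ z)

namespace Cmp

variable {ι : Type} {K : ι → ℕ} {X Y : ι → Data}

/-- Iteration of a function on data that decreases a measure. -/
theorem loop_fun {F : Data → Data} (hF : Cmp (ι := Data) Data.size (fun x => x) F) (μ : Data → ℕ)
    (hμ : ∀ x, (F x).head ≠ num 0 → μ (F x).tail < μ x)
    {l : ι → ℕ} (hl : PolyBdd K l) {S : ι → ℕ → Data}
    (hS : PolyBdd (fun z : Σ a, Fin (l a + 1) => K z.1) fun z => (S z.1 z.2).size)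
    (hnext : ∀ a, ∀ m < l a, F (S a m) = .cons (num 1) (S a (m + 1)))
    (hlast : ∀ a, F (S a (l a)) = .cons (num 0) (Y a)) : Cmp K (fun a => S a 0) Y := by
  obtain ⟨c, hc, t, hr, ht⟩ := hF
  have hF' : ∀ {κ : Type} {K' : κ → ℕ} {X' : κ → Data}, PolyBdd K' (fun a => (X' a).size) →
      ComputedBy c K' X' fun a => F (X' a) := fun {κ K' X'} h =>
    ⟨fun a => t (X' a), fun a => hr _, (ht.reindex X').trans h⟩
  refine ⟨.loop c, .loop μ fun x => ⟨F x, t x, hr x, hμ x⟩, .loop hl ?_ ?_⟩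
  · have := hF' (hS.reindex fun z : (Σ a, Fin (l a)) => ⟨z.1, z.2.castSucc⟩)
    exact this.of_exists fun z => ⟨z, rfl, rfl, hnext z.1 z.2 z.2.2⟩
  · have := hF' (hS.reindex fun a => ⟨a, Fin.last (l a)⟩)
    exact this.of_exists fun a => ⟨a, rfl, rfl, hlast a⟩

/-- Bits are counted by halving: `n / 2 ^ m` first vanishes at `m = Nat.size n`. This supplies the
number of rounds of repeated squaring. -/
theorem natSize {n : ι → ℕ} (h : Cmp K X fun a => num (n a)) :
    Cmp K X fun a => num (Nat.size (n a)) := by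
  let F : Data → Data := fun x => if x.head.val + 0 ≠ 0 then
    .cons (num 1) (.cons (num (x.head.val / 2)) (num (x.tail.val + 1))) else .cons (num 0) x.tail
  have r : Cmp (ι := Data) Data.size (fun x => x) fun x => x := .refl .self
  have hv : Cmp (ι := Data) Data.size (fun x => x) fun x => num (x.head.val / 2) :=
    (r.head.cons (.lit .self 2)).op .div
  have ht : Cmp (ι := Data) Data.size (fun x => x) fun x => num (x.tail.val + 1) :=
    (r.tail.cons (.lit .self 1)).op .add
  have hF : Cmp (ι := Data) Data.size (fun x => x) F :=
    .ite (c := fun x => x.head.val + 0) ((r.head.cons (.lit .self 0)).op .add)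
      ((lit .self 1).cons (hv.cons ht)) ((lit .self 0).cons r.tail) fun _ => Iff.rfl
  have hl : PolyBdd K fun a => Nat.size (n a) := h.right.mono fun a => by simp [size]
  have hstart : Cmp K X fun a => .cons (num (n a)) (num 0) := h.cons (.lit h.left 0)
  refine hstart.trans ?_
  have := loop_fun (K := K) hF (fun x => x.head.val) ?_ hl
    (S := fun a m => .cons (num (n a / 2 ^ m)) (num m)) (Y := fun a => num (Nat.size (n a)))
    ?_ ?_ ?_
  · simpa using this
  · intro x hx
    by_cases h0 : x.head.val + 0 ≠ 0
    · simp only [F, if_pos h0, tail_cons, head_cons, val_num]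
      omega
    · exact absurd (by simp only [F, if_neg h0, head_cons]) hx
  · refine PolyBdd.mono (((h.right.add hl).add (.const 3)).reindex
      fun z : (Σ a, Fin (Nat.size (n a) + 1)) => z.1) fun z => ?_
    have h1 : (num (n z.1 / 2 ^ (z.2 : ℕ))).size ≤ (num (n z.1)).size :=
      size_num_le (Nat.div_le_self _ _)
    have h2 : Nat.size z.2 ≤ Nat.size (n z.1) :=
      (Nat.size_le_size (Nat.le_of_lt_succ z.2.2)).trans
        (Nat.size_le.2 (Nat.lt_pow_self one_lt_two))
    simp only [size] at *
    omega
  · intro a m hm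
    have h0 : n a / 2 ^ m + 0 ≠ 0 := by
      have := Nat.lt_size.1 hm
      have := Nat.div_pos this (by positivity)
      omega
    simp only [F, head_cons, val_num, if_pos h0, tail_cons, pow_succ, Nat.div_div_eq_div_mul]
  · intro a
    have h0 : ¬ (n a / 2 ^ Nat.size (n a) + 0 ≠ 0) := by
      simp [Nat.lt_size_self]
    exact if_neg h0

/-- The remaining list drives the loop. On arbitrary data the loop halts because the tail of an
inner node is smaller. -/
theorem length {xs : ι → List Data} (h : Cmp K X fun a => ofList (xs a)) :
    Cmp K X fun a => num (xs a).length := by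
  let F : Data → Data := fun x => if x.head.isLeaf.val + 0 ≠ 0 then .cons (num 0) x.tail else
    .cons (num 1) (.cons x.head.tail (num (x.tail.val + 1)))
  have r : Cmp (ι := Data) Data.size (fun x => x) fun x => x := .refl .self
  have ht : Cmp (ι := Data) Data.size (fun x => x) fun x => num (x.tail.val + 1) :=
    (r.tail.cons (.lit .self 1)).op .add
  have hF : Cmp (ι := Data) Data.size (fun x => x) F :=
    .ite (c := fun x => x.head.isLeaf.val + 0) ((r.head.isLeaf.cons (.lit .self 0)).op .add)
      ((lit .self 0).cons r.tail) ((lit .self 1).cons (r.head.tail.cons ht)) fun _ => Iff.rfl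
  have hl : PolyBdd K fun a => (xs a).length := h.right.mono fun a => length_le_size_ofList _
  have hstart : Cmp K X fun a => .cons (ofList (xs a)) (num 0) := h.cons (.lit h.left 0)
  refine hstart.trans ?_
  have := loop_fun (K := K) hF (fun x => x.head.size) ?_ hl
    (S := fun a m => .cons (ofList ((xs a).drop m)) (num m)) (Y := fun a => num (xs a).length)
    ?_ ?_ ?_
  · simpa using this
  · intro x hx
    by_cases h0 : x.head.isLeaf.val + 0 ≠ 0
    · exact absurd (by simp only [F, if_pos h0, head_cons]) hx
    · simp only [F, if_neg h0]
      change x.head.tail.size < x.head.size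
      cases hx : x.head with
      | num n => simp [hx, Data.isLeaf, val] at h0
      | cons u v => simp only [Data.tail, size]; omega
  · refine PolyBdd.mono (((h.right.add hl).add (.const 3)).reindex
      fun z : (Σ a, Fin ((xs a).length + 1)) => z.1) fun z => ?_
    have h1 := size_tail_iterate_le (ofList (xs z.1)) z.2
    rw [tail_iterate_ofList] at h1
    have h2 : Nat.size z.2 ≤ (xs z.1).length :=
      (Nat.size_le_size (Nat.le_of_lt_succ z.2.2)).trans
        (Nat.size_le.2 (Nat.lt_pow_self one_lt_two))
    simp only [size] at *
    omega
  · intro a m hm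
    simp only [F, List.drop_eq_getElem_cons hm, ofList, head_cons, tail_cons, isLeaf_cons, val_num]
    rfl
  · intro a
    simp [F, ofList]

/-- Access to a member of a finite family. -/
theorem get {l : ι → ℕ} {f : ∀ a, Fin (l a) → Data} (hf : Cmp K X fun a => encFam (f a))
    {n : ∀ a, Fin (l a)} (hn : Cmp K X fun a => num (n a)) : Cmp K X fun a => f a (n a) := by
  have hb : PolyBdd K fun a => (n a : ℕ) :=
    hf.right.mono fun a => (n a).2.le.trans (le_size_encFam _)
  have := forLoop (A := fun a m => Data.tail^[n a - m] (encFam (f a))) hn hb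
    ((hf.right.reindex _).mono fun z => size_tail_iterate_le _ _) (hf.congr fun a => by simp)
    fun X' _ _ h => h.tail.congr fun z => by
      rw [← Function.iterate_succ_apply' Data.tail]
      congr 2; have := z.2.2; omega
  exact this.head.congr fun a => by
    rw [Nat.sub_zero, encFam, tail_iterate_ofList, head_drop_ofFn]

/-- Computation of a finite family, member by member. -/
theorem tabulate {l : ι → ℕ} (hl : Cmp K X fun a => num (l a)) (hlb : PolyBdd K l)
    {g : ∀ a, Fin (l a) → Data}
    (hg : ∀ X' : (Σ a, Fin (l a)) → Data, Lifts K X Sigma.fst X' →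
      Cmp (fun z => K z.1) X' (fun z => num z.2) → Cmp (fun z => K z.1) X' fun z => g z.1 z.2) :
    Cmp K X fun a => encFam (g a) := by
  -- The bound on the members is read off from `hg` itself, applied to a concrete pair of index and
  -- input.
  have hbd : PolyBdd (fun z : Σ a, Fin (l a) => K z.1) fun z => (g z.1 z.2).size := by
    have hX := hl.left.reindex fun z : (Σ a, Fin (l a)) => z.1
    have hn : PolyBdd (fun z : Σ a, Fin (l a) => K z.1) fun z => (num z.2).size :=
      (hl.right.reindex fun z : (Σ a, Fin (l a)) => z.1).mono fun z => size_num_le z.2.2.le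
    have hS : PolyBdd (fun z : Σ a, Fin (l a) => K z.1)
        fun z => (Data.cons (num z.2) (X z.1)).size := (hn.add hX).add (.const 1)
    have r := Cmp.refl hS
    exact (hg _ (fun Y hY => r.tail.trans (hY.reindex fun z : (Σ a, Fin (l a)) => z.1))
      r.head).right
  -- The list is built from its end: at counter `n` it holds the members from `n` on.
  have := forLoop (A := fun a n => ofList ((List.ofFn (g a)).drop n)) hl hlb ?_
    ((lit hl.left 0).congr fun a => by rw [List.drop_eq_nil_of_le (by simp)]; rfl)
    fun X' hL hn hA =>
      ((hg X' hL hn).cons hA).congr fun z => by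
        rw [List.drop_eq_getElem_cons (i := z.2) (by simp)]
        simp [ofList]
  · simpa [encFam] using this
  · obtain ⟨q, hq⟩ := hbd
    refine PolyBdd.mono (f := fun z : (Σ a, Fin (l a + 1)) => l z.1 * (q.eval (K z.1) + 1) + 1)
      (PolyBdd.reindex ((hlb.mul ((PolyBdd.self.eval q).add (.const 1))).add (.const 1)) _)
      fun z => ?_
    refine (size_ofList_le (B := q.eval (K z.1)) fun x hx => ?_).trans ?_
    · obtain ⟨n, rfl⟩ := (List.mem_ofFn' _ _).1 (List.mem_of_mem_drop hx)
      exact hq ⟨z.1, n⟩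
    · gcongr; simp

/-- Search for the first index with some property. -/
theorem search {l : ι → ℕ} (hl : Cmp K X fun a => num (l a)) (hlb : PolyBdd K l)
    {A : ι → ℕ → ℕ} {t : (Σ a, Fin (l a)) → ℕ} (hA : ∀ a n, A a n ≤ l a)
    (hA0 : ∀ a, A a (l a) = 0)
    (hrec : ∀ a (n : Fin (l a)), A a n = if t ⟨a, n⟩ ≠ 0 then (n : ℕ) else A a (n + 1))
    (ht : ∀ X' : (Σ a, Fin (l a)) → Data, Lifts K X Sigma.fst X' →
      Cmp (fun z => K z.1) X' (fun z => num z.2) → Cmp (fun z => K z.1) X' fun z => num (t z)) :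
    Cmp K X fun a => num (A a 0) := by
  -- Counting down, each hit overwrites the previous one, so the least index survives; `0` is the
  -- default if there is none.
  refine forLoop (A := fun a n => num (A a n)) hl hlb
    ((hl.right.reindex _).mono fun z => size_num_le (hA _ _))
    ((lit hl.left 0).congr fun a => by rw [hA0]) fun X' hL hn h => ?_
  exact ((ht X' hL hn).ite_num hn h (p := fun z => t z ≠ 0) fun _ => Iff.rfl).congr
    fun z => by rw [hrec]

/-! ### Powers -/

/-- Here the exponent itself, not just its length, is polynomially bounded, so the power has
polynomially many bits. -/
theorem two_pow {n : ι → ℕ} (hn : Cmp K X fun a => num (n a)) (hb : PolyBdd K n) :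
    Cmp K X fun a => num (2 ^ n a) := by
  have := forLoop (A := fun a m => num (2 ^ (n a - m))) hn hb
    (((hb.add (.const 2)).reindex fun z : (Σ a, Fin (n a + 1)) => z.1).mono fun z => by
      simp only [size, Nat.size_pow]; omega)
    ((lit hn.left 1).congr fun a => by simp) fun X' hL _ h =>
      (h.mul (hL _ (lit hn.left 2))).congr fun z => by
        rw [← pow_succ]; congr 2; have := z.2.2; omega
  simpa using this

/-- Powers by repeated squaring. -/
theorem npow {M : ι → Type} [∀ a, Monoid (M a)] {E : ∀ a, M a → Data}
    (hE : PolyBdd (fun z : Σ a, M a => K z.1) fun z => (E z.1 z.2).size)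
    {x : ι → ℕ} (hx : Cmp K X fun a => num (x a))
    (hmul : ∀ (X' : (Σ a, Fin (Nat.size (x a))) → Data) (u v : ∀ z, M z.1),
      Lifts K X Sigma.fst X' → Cmp (fun z => K z.1) X' (fun z => E z.1 (u z)) →
      Cmp (fun z => K z.1) X' (fun z => E z.1 (v z)) →
      Cmp (fun z => K z.1) X' fun z => E z.1 (u z * v z))
    (h1 : Cmp K X fun a => E a 1) {u : ∀ a, M a} (hu : Cmp K X fun a => E a (u a)) :
    Cmp K X fun a => E a (u a ^ x a) := by
  have hs := hx.natSize
  have hsb : PolyBdd K fun a => Nat.size (x a) := hx.right.mono fun a => by simp [size]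
  -- Horner's rule on the binary digits of the exponent, from the top. Since `hE` bounds all
  -- elements, the accumulators do not grow.
  have := forLoop (A := fun a n => E a (u a ^ (x a / 2 ^ n))) hs hsb
    (hE.reindex fun z : (Σ a, Fin (Nat.size (x a) + 1)) => ⟨z.1, _⟩)
    (h1.congr fun a => by rw [Nat.div_eq_of_lt (Nat.lt_size_self _), pow_zero]) ?_
  · simpa using this
  · intro X' hL hn h
    have h2 := hL _ (lit hx.left 2)
    have hbit := ((hL _ hx).div (hn.two_pow ((hsb.reindex _).mono fun z => z.2.2.le))).mod h2
    have hf := hbit.ite (hL _ hu) (hL _ h1) (p := fun z => x z.1 / 2 ^ (z.2 : ℕ) % 2 ≠ 0)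
      fun _ => Iff.rfl
    refine (hmul X' _ (fun z => if x z.1 / 2 ^ (z.2 : ℕ) % 2 ≠ 0 then u z.1 else 1) hL
      (hmul X' _ _ hL h h) (hf.congr fun z => by split_ifs <;> rfl)).congr fun z => ?_
    congr 1
    -- Passing from digit `n + 1` to digit `n` doubles the quotient and adds the digit.
    have e : x z.1 / 2 ^ (z.2 : ℕ) = x z.1 / 2 ^ ((z.2 : ℕ) + 1) + x z.1 / 2 ^ ((z.2 : ℕ) + 1) +
        x z.1 / 2 ^ (z.2 : ℕ) % 2 := by
      rw [pow_succ, ← Nat.div_div_eq_div_mul]; omega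
    conv_rhs => rw [e, pow_add, pow_add]
    congr 1
    rcases Nat.mod_two_eq_zero_or_one (x z.1 / 2 ^ (z.2 : ℕ)) with h | h <;> simp [h]

end Cmp

variable {ι : Type} {K : ι → ℕ} {X Y : ι → Data}

namespace Cmp

theorem cases_prop {p : ι → Prop} {c : ι → ℕ} (hc : Cmp K X fun a => num (c a))
    (hp : ∀ a, p a ↔ c a ≠ 0)
    (h1 : Cmp (fun z : {a // p a} => K z) (fun z => X z) fun z => Y z)
    (h0 : Cmp (fun z : {a // ¬p a} => K z) (fun z => X z) fun z => Y z) : Cmp K X Y :=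
  cases hc
    (h1.of_exists fun z => ⟨⟨z.1, (hp _).2 fun h => z.2 (by rw [h])⟩, rfl, rfl, rfl⟩)
    (h0.of_exists fun z => ⟨⟨z.1, fun h => (hp _).1 h (num.inj z.2)⟩, rfl, rfl, rfl⟩)

/-! ### Arithmetic modulo a prime -/

/-- A number that vanishes iff `u a ≠ v a`. -/
theorem eq_test {u v : ι → ℕ} (hu : Cmp K X fun a => num (u a)) (hv : Cmp K X fun a => num (v a)) :
    Cmp K X fun a => num (1 - ((u a - v a) + (v a - u a))) :=
  (lit hu.left 1).sub ((hu.sub hv).add (hv.sub hu))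

section zmod

variable {p : ι → ℕ} [∀ a, Fact (p a).Prime] (hp : Cmp K X fun a => num (p a))
  {x y : ∀ a, ZMod (p a)}
include hp

theorem zmod_mul (hx : Cmp K X fun a => encZ (x a)) (hy : Cmp K X fun a => encZ (y a)) :
    Cmp K X fun a => encZ (x a * y a) :=
  ((hx.mul hy).mod hp).congr fun a => by rw [encZ, ZMod.val_mul]

theorem zmod_add (hx : Cmp K X fun a => encZ (x a)) (hy : Cmp K X fun a => encZ (y a)) :
    Cmp K X fun a => encZ (x a + y a) :=
  ((Cmp.add hx hy).mod hp).congr fun a => by rw [encZ, ZMod.val_add]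

theorem zmod_neg (hx : Cmp K X fun a => encZ (x a)) : Cmp K X fun a => encZ (-x a) :=
  ((hp.sub hx).mod hp).congr fun a => by rw [encZ, ZMod.neg_val']

theorem zmod_inv (hx : Cmp K X fun a => encZ (x a)) : Cmp K X fun a => encZ (x a)⁻¹ := by
  have h := npow (K := K) (M := fun a => ZMod (p a)) (E := fun a x => encZ x)
    ((hp.right.reindex _).mono fun z => size_num_le (ZMod.val_lt z.2).le)
    -- By Fermat, the exponent `2p - 3 = 2(p - 1) - 1` gives the inverse. Unlike `p - 2` it is
    -- positive for `p = 2` too, so that `0` is sent to `0`.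
    (((lit hp.left 2).mul hp).sub (lit hp.left 3))
    (fun X' u v hL hu hv => zmod_mul (hL _ hp) hu hv)
    (((lit hp.left 1).mod hp).congr fun a => by rw [encZ, ZMod.val_one_eq_one_mod]) hx
  refine h.congr fun a => ?_
  have h2 := (Fact.out : (p a).Prime).two_le
  congr 1
  by_cases h0 : x a = 0
  · rw [h0, inv_zero, zero_pow (by omega)]
  · refine eq_inv_of_mul_eq_one_left ?_
    rw [← pow_succ, show 2 * p a - 3 + 1 = (p a - 1) * 2 by omega, pow_mul,
      ZMod.pow_card_sub_one_eq_one h0, one_pow]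

end zmod

/-! ### Bilinear groups -/

theorem polyTime {f : Data → Data} (hf : PolyTime f) (h : Cmp K X Y) :
    Cmp K X fun a => f (Y a) := by
  obtain ⟨c, q, hq⟩ := hf
  choose t ht hr using hq
  exact h.trans ⟨c, fun x => ⟨_, _, hr x⟩, fun a => t (Y a), fun a => hr _,
    (h.right.eval q).mono fun a => ht _⟩

section group

variable {B : BilinearGenerator} {i : ι → B.ι} (hd : Cmp K X fun a => B.desc (i a))
  {u v : ∀ a, B.G (i a)}
include hd

theorem mulG (hu : Cmp K X fun a => B.encG (i a) (u a)) (hv : Cmp K X fun a => B.encG (i a) (v a)) :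
    Cmp K X fun a => B.encG (i a) (u a * v a) := by
  obtain ⟨f, hf, h⟩ := B.mulG_poly
  exact (polyTime hf (hd.cons (hu.cons hv))).congr fun a => h _ _ _

theorem invG (hu : Cmp K X fun a => B.encG (i a) (u a)) :
    Cmp K X fun a => B.encG (i a) (u a)⁻¹ := by
  obtain ⟨f, hf, h⟩ := B.invG_poly
  exact (polyTime hf (hd.cons hu)).congr fun a => h _ _

theorem powG (hE : PolyBdd (fun z : Σ a, B.G (i a) => K z.1) fun z => (B.encG (i z.1) z.2).size)
    (hu : Cmp K X fun a => B.encG (i a) (u a)) {x : ∀ a, ZMod (B.p (i a))}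
    (hx : Cmp K X fun a => encZ (x a)) : Cmp K X fun a => B.encG (i a) (pw (u a) (x a)) :=
  npow (M := fun a => B.G (i a)) (E := fun a => B.encG (i a)) hE hx
    (fun _ _ _ hL hu hv => mulG (hL _ hd) hu hv)
    -- The neutral element is obtained as `u * u⁻¹`, from the operations that the generator
    -- provides.
    ((mulG hd hu (invG hd hu)).congr fun a => by rw [mul_inv_cancel]) hu

end group

/-! ### Linear secret sharing schemes -/

section lsss

variable {p n : ι → ℕ} {M : ∀ a, LSSS (p a) (n a)} {j r : ∀ a, Fin (M a).rows}

theorem rows_bdd (hM : Cmp K X fun a => encLSSS (M a)) : PolyBdd K fun a => (M a).rows :=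
  hM.tail.right.mono fun _ => le_size_encFam _

theorem rows (hM : Cmp K X fun a => encLSSS (M a)) : Cmp K X fun a => num (M a).rows :=
  (length (xs := fun _ => List.ofFn _) hM.tail).congr fun a => by rw [List.length_ofFn]

theorem cols (hM : Cmp K X fun a => encLSSS (M a)) : Cmp K X fun a => num ((M a).cols + 1) :=
  Cmp.add hM.head (lit hM.left 1)

theorem label (hM : Cmp K X fun a => encLSSS (M a)) (hr : Cmp K X fun a => num (r a)) :
    Cmp K X fun a => encAttr ((M a).ψ (r a)) :=
  (get hM.tail hr).head

/-- The number of columns is stored in binary, so its code alone gives no polynomial bound; an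
actual row does, as it lists all its entries. -/
theorem cols_bdd (hM : Cmp K X fun a => encLSSS (M a)) (hr : Cmp K X fun a => num (r a)) :
    PolyBdd K fun a => (M a).cols + 1 :=
  (get hM.tail hr).tail.right.mono fun _ => le_size_encFam _

theorem entry (hM : Cmp K X fun a => encLSSS (M a)) (hr : Cmp K X fun a => num (r a))
    {c : ∀ a, Fin ((M a).cols + 1)} (hc : Cmp K X fun a => num (c a)) :
    Cmp K X fun a => encZ ((M a).H (r a) (c a)) :=
  get (get hM.tail hr).tail hc

/-- A challenge names the attribute and not the row. Since `ψ` is injective, a linear search for the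
label recovers `j`. -/
theorem rowIndex (hM : Cmp K X fun a => encLSSS (M a)) (hI : ∀ a, (M a).Ideal)
    (hy : Cmp K X fun a => encAttr ((M a).ψ (j a))) : Cmp K X fun a => num (j a) := by
  have := search (A := fun a m => if m ≤ (j a : ℕ) then (j a : ℕ) else 0)
    (t := fun z => 1 - ((((M z.1).ψ z.2 : ℕ) - ((M z.1).ψ (j z.1) : ℕ)) +
      (((M z.1).ψ (j z.1) : ℕ) - ((M z.1).ψ z.2 : ℕ))))
    (rows hM) (rows_bdd hM) (fun a m => ?_) (fun a => if_neg (j a).2.not_ge) (fun a m => ?_)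
    fun X' hL hn => eq_test (label (hL _ hM) hn) (hL _ hy)
  · simpa using this
  · have := (j a).2; split_ifs <;> omega
  · by_cases h : m = j a
    · subst h; simp
    · have h1 : (((M a).ψ m : ℕ)) ≠ ((M a).ψ (j a) : ℕ) := fun e => h (hI a (Fin.ext e))
      have h2 : (m : ℕ) ≠ j a := fun e => h (Fin.ext e)
      rw [if_neg (show ¬ (1 - ((((M a).ψ m : ℕ) - ((M a).ψ (j a) : ℕ)) +
        (((M a).ψ (j a) : ℕ) - ((M a).ψ m : ℕ))) ≠ 0) by omega)]
      split_ifs <;> omega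

variable [∀ a, Fact (p a).Prime] (hp : Cmp K X fun a => num (p a))

theorem pivot (hM : Cmp K X fun a => encLSSS (M a)) (hj : Cmp K X fun a => num (j a)) :
    Cmp K X fun a => num ((M a).pivot (j a)) := by
  let P : ∀ a, Fin ((M a).cols + 1) → Bool := fun a k => decide (k ≠ 0 ∧ (M a).H (j a) k ≠ 0)
  have := search (A := fun a m =>
      (((List.finRange ((M a).cols + 1)).drop m).find? (P a)).getD 0)
    -- The product is nonzero iff the column is not the first and the entry does not vanish; the
    -- default `0` of the search agrees with that of `pivot`.
    (t := fun z => z.2 * ((M z.1).H (j z.1) z.2).val)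
    (cols hM) (cols_bdd hM hj) (fun a m => Fin.is_le') (fun a => ?_) (fun a m => ?_)
    fun X' hL hn => Cmp.mul hn (entry (hL _ hM) (hL _ hj) hn)
  · exact this.congr fun a => rfl
  · rw [List.drop_eq_nil_of_le (by simp)]; rfl
  · rw [List.drop_eq_getElem_cons (i := m) (by rw [List.length_finRange]; exact m.2),
      List.find?_cons]
    have e : (List.finRange ((M a).cols + 1))[(m : ℕ)]'(by
      rw [List.length_finRange]; exact m.2) = m := by simp
    have hP : P a m = true ↔ (m : ℕ) * ((M a).H (j a) m).val ≠ 0 := by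
      simp only [P, decide_eq_true_eq, ne_eq, mul_eq_zero, not_or, ZMod.val_eq_zero,
        Fin.ext_iff, Fin.val_zero]
    rw [e]
    by_cases h : P a m = true
    · rw [h, if_pos (hP.1 h)]; rfl
    · rw [if_neg fun h' => h (hP.2 h')]
      simp only [Bool.not_eq_true] at h
      rw [h]

include hp in
theorem coeff (hM : Cmp K X fun a => encLSSS (M a)) (hj : Cmp K X fun a => num (j a))
    (hr : Cmp K X fun a => num (r a)) : Cmp K X fun a => encZ ((M a).coeff (j a) (r a)) := by
  have hk := pivot hM hj
  exact (zmod_mul hp (entry hM hr hk) (zmod_inv hp (entry hM hj hk))).congr fun a => by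
    rw [LSSS.coeff, div_eq_mul_inv]

theorem skip {l : ι → ℕ} {j : ∀ a, Fin (l a)} {r : ∀ a, Fin (l a - 1)}
    (hj : Cmp K X fun a => num (j a)) (hr : Cmp K X fun a => num (r a)) :
    Cmp K X fun a => num (LSSS.skip (j a) (r a)) := by
  have h := ite_num (p := fun a => (r a : ℕ) < j a) (Cmp.sub hj hr) hr
    (Cmp.add hr (lit hj.left 1)) fun a => by omega
  exact h.congr fun a => by rw [LSSS.skip]; split_ifs <;> rfl

include hp in
theorem contract (hM : Cmp K X fun a => encLSSS (M a)) (hj : Cmp K X fun a => num (j a)) :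
    Cmp K X fun a => encLSSS ((M a).contract (j a)) := by
  refine hM.head.cons (tabulate ((rows hM).sub (lit hM.left 1))
    ((rows_bdd hM).mono fun a => Nat.sub_le _ _) fun X' hL hn => ?_)
  have hM' := hL _ hM
  have hj' := hL _ hj
  have hp' := hL _ hp
  have hs := skip hj' hn
  have hc := coeff hp' hM' hj' hs
  refine (label hM' hs).cons (tabulate (cols hM') (cols_bdd hM' hj') fun X'' hL' hm => ?_)
  exact (zmod_add (hL' _ hp') (entry (hL' _ hM') (hL' _ hs) hm) (zmod_neg (hL' _ hp')
    (zmod_mul (hL' _ hp') (hL' _ hc) (entry (hL' _ hM') (hL' _ hj') hm)))).congr fun z => by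
      simp [LSSS.contract, sub_eq_add_neg]

end lsss

end Cmp

/-! ### Reconstruction of a ciphertext from its contraction -/

/-- The index that `skip j` maps to `l`. -/
def unskip {m : ℕ} (j l : Fin m) (h : l ≠ j) : Fin (m - 1) :=
  ⟨if l.1 < j.1 then l.1 else l.1 - 1, by
    have : l.1 ≠ j.1 := fun e => h (Fin.ext e)
    split_ifs <;> omega⟩

theorem skip_unskip {m : ℕ} (j l : Fin m) (h : l ≠ j) : LSSS.skip j (unskip j l h) = l := by
  have : l.1 ≠ j.1 := fun e => h (Fin.ext e)
  apply Fin.ext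
  simp only [LSSS.skip, unskip]
  split_ifs <;> simp <;> omega

theorem skip_ne {m : ℕ} (j : Fin m) (l : Fin (m - 1)) : LSSS.skip j l ≠ j := by
  intro e
  have := congrArg Fin.val e
  simp only [LSSS.skip] at this
  split_ifs at this <;> simp at this <;> omega

theorem unskip_skip {m : ℕ} (j : Fin m) (l : Fin (m - 1)) :
    unskip j (LSSS.skip j l) (skip_ne j l) = l := by
  apply Fin.ext
  simp only [LSSS.skip, unskip]
  split_ifs <;> simp at *; all_goals omega

/-- A ciphertext for `M` from one for the contraction of `M` at `ψ j`, the share `w` of row `j` and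
the exponent `ρ` for row `j`. -/
def reconstruct {B : BilinearGenerator} {i : B.ι} {n : ℕ} (pk : PublicKey B i n)
    {M : LSSS (B.p i) n} (j : Fin M.rows) (w ρ : ZMod (B.p i))
    (ct : Ciphertext B i (M.contract j)) : Ciphertext B i M where
  C := ct.C
  C' := ct.C'
  Ci := fun l => if h : l = j then pw pk.ga w * pw (pk.T (M.ψ j)) (-ρ)
    else ct.Ci (unskip j l h) * pw pk.ga (w * M.coeff j l)
  Di := fun l => if h : l = j then pw pk.g ρ else ct.Di (unskip j l h)

theorem Cmp.unskip {l : ι → ℕ} {j r : ∀ a, Fin (l a)} (h : ∀ a, r a ≠ j a)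
    (hj : Cmp K X fun a => num (j a)) (hr : Cmp K X fun a => num (r a)) :
    Cmp K X fun a => num (CPABE.unskip (j a) (r a) (h a)) :=
  ite_num (p := fun a => (r a : ℕ) < j a) (Cmp.sub hj hr) hr
    (Cmp.sub hr (lit hj.left 1)) fun a => by omega

/-- Only public data, the two exponents and the given ciphertext enter; neither the secret vector
nor the master key is needed. -/
theorem Cmp.reconstruct {B : BilinearGenerator} {i : ι → B.ι} {n : ι → ℕ}
    (hE : PolyBdd (fun z : Σ a, B.G (i a) => K z.1) fun z => (B.encG (i z.1) z.2).size)
    {pk : ∀ a, PublicKey B (i a) (n a)} (hpk : Cmp K X fun a => encPK (pk a))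
    {M : ∀ a, LSSS (B.p (i a)) (n a)} (hM : Cmp K X fun a => encLSSS (M a))
    {j : ∀ a, Fin (M a).rows} (hj : Cmp K X fun a => num (j a))
    {w ρ : ∀ a, ZMod (B.p (i a))} (hw : Cmp K X fun a => encZ (w a))
    (hρ : Cmp K X fun a => encZ (ρ a)) {ct : ∀ a, Ciphertext B (i a) ((M a).contract (j a))}
    (hct : Cmp K X fun a => encCT (ct a)) :
    Cmp K X fun a => encCT (CPABE.reconstruct (pk a) (j a) (w a) (ρ a) (ct a)) := by
  have hp : Cmp K X fun a => num (B.p (i a)) := hpk.head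
  have hd : Cmp K X fun a => B.desc (i a) := hpk.tail.head
  have hg : Cmp K X fun a => B.encG (i a) (pk a).g := hpk.tail.tail.head
  have hga : Cmp K X fun a => B.encG (i a) (pk a).ga := hpk.tail.tail.tail.head
  have hT := hpk.tail.tail.tail.tail.tail.head
  have hTj : Cmp K X fun a => B.encG (i a) ((pk a).T ((M a).ψ (j a))) :=
    get hT (label hM hj)
  have hcomp := hct.tail.tail.tail.head
  have hCj := mulG hd (powG hd hE hga hw) (powG hd hE hTj (zmod_neg hp hρ))
  have hDj := powG hd hE hg hρ
  refine hM.cons (hct.tail.head.cons (hct.tail.tail.head.cons (Cmp.cons ?_ (lit hM.left 0))))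
  refine tabulate (rows hM) (rows_bdd hM) fun X' hL hn => ?_
  refine cases_prop (p := fun z => z.2 = j z.1) (eq_test hn (hL _ hj))
    (fun z => by rw [Fin.ext_iff]; omega) ?_ ?_
  · refine ((hL _ (hCj.cons hDj)).reindex _).congr fun z => ?_
    simp only [CPABE.reconstruct, z.2, dif_pos]
  · let κ := {z : Σ a, Fin (M a).rows // z.2 ≠ j z.1}
    have hL' : ∀ Y, Cmp K X Y → Cmp (fun z : κ => K z.1.1) (fun z => X' z.1) fun z => Y z.1.1 :=
      fun Y hY => (hL _ hY).reindex _
    have hn' := hn.reindex fun z : κ => z.1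
    have hx := get (hL' _ hcomp) (Cmp.unskip (fun z => z.2) (hL' _ hj) hn')
    have hE' : PolyBdd (fun z : Σ a : κ, B.G (i a.1.1) => K z.1.1.1)
      fun z => (B.encG (i z.1.1.1) z.2).size :=
        hE.reindex fun z : (Σ a : κ, B.G (i a.1.1)) => ⟨z.1.1.1, z.2⟩
    have hpow := powG (hL' _ hd) hE' (hL' _ hga) (zmod_mul (hL' _ hp) (hL' _ hw)
      (coeff (hL' _ hp) (hL' _ hM) (hL' _ hj) hn'))
    refine ((mulG (hL' _ hd) hx.head hpow).cons hx.tail).congr fun z => ?_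
    simp only [CPABE.reconstruct, dif_neg z.2]
    rfl

/-! ### Uniform distributions -/

section uniform

variable {α β γ δ : Type} [Fintype α] [Nonempty α] [Fintype β] [Nonempty β] [Fintype γ] [Nonempty γ]

theorem uniformOfFintype_map {f : α → β} (hf : f.Bijective) :
    (PMF.uniformOfFintype α).map f = PMF.uniformOfFintype β := by
  ext b
  obtain ⟨a, rfl⟩ := hf.2 b
  rw [PMF.map_apply, tsum_eq_single a fun a' h => if_neg fun e => h (hf.1 e.symm), if_pos rfl,
    PMF.uniformOfFintype_apply, PMF.uniformOfFintype_apply, Fintype.card_of_bijective hf]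

theorem uniformOfFintype_bind {f : α → β} (hf : f.Bijective) (g : β → PMF δ) :
    ((PMF.uniformOfFintype α).bind fun a => g (f a)) = (PMF.uniformOfFintype β).bind g := by
  rw [← uniformOfFintype_map hf, PMF.bind_map]; rfl

theorem uniformOfFintype_bind_map {f : α → β → γ}
    (hf : Function.Bijective fun x : α × β => f x.1 x.2) :
    ((PMF.uniformOfFintype α).bind fun a => (PMF.uniformOfFintype β).map fun b => f a b) =
      PMF.uniformOfFintype γ := by
  ext c
  obtain ⟨⟨a, b⟩, rfl⟩ := hf.2 c
  rw [PMF.bind_apply, tsum_eq_single a, PMF.map_apply, tsum_eq_single b, if_pos rfl]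
  · rw [PMF.uniformOfFintype_apply, PMF.uniformOfFintype_apply, PMF.uniformOfFintype_apply,
      ← Fintype.card_of_bijective hf, Fintype.card_prod, Nat.cast_mul,
      ENNReal.mul_inv (by simp) (by simp)]
  · intro b' h
    exact if_neg fun e => h (congrArg Prod.snd (@hf.1 (a, b) (a, b') e)).symm
  · intro a' h
    rw [PMF.map_apply, ENNReal.tsum_eq_zero.2, mul_zero]
    exact fun b' => if_neg fun e => h (congrArg Prod.fst (@hf.1 (a, b) (a', b') e)).symm

end uniform

/-! ### Powers in groups of prime order -/

section pw

variable {G : Type} [CommGroup G] {p : ℕ}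

theorem pw_zero [Fact p.Prime] (u : G) : pw u (0 : ZMod p) = 1 := by simp [pw]

variable [Fintype G] (hG : Fintype.card G = p)
include hG

theorem pow_mod_of_card_eq (u : G) (k : ℕ) : u ^ (k % p) = u ^ k := by
  subst hG
  exact pow_mod_card u k

variable [Fact p.Prime]

theorem pw_add (u : G) (x y : ZMod p) : pw u (x + y) = pw u x * pw u y := by
  rw [pw, pw, pw, ← pow_add, ZMod.val_add, pow_mod_of_card_eq hG]

theorem pw_mul (u : G) (x y : ZMod p) : pw u (x * y) = pw (pw u x) y := by
  rw [pw, pw, pw, ← pow_mul, ZMod.val_mul, pow_mod_of_card_eq hG]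

theorem pw_neg (u : G) (x : ZMod p) : pw u (-x) = (pw u x)⁻¹ := by
  rw [eq_inv_iff_mul_eq_one, ← pw_add hG, neg_add_cancel, pw_zero]

end pw

/-! ### Contraction of a linear secret sharing scheme -/

namespace LSSS

variable {p n : ℕ} [Fact p.Prime] {M : LSSS p n} {j : Fin M.rows}

/-- The pivot of a row whose label is not authorized is found. -/
theorem pivot_spec (hI : M.Ideal) (hc : M.Connected) (hj : {M.ψ j} ∉ M.access) :
    M.pivot j ≠ 0 ∧ M.H j (M.pivot j) ≠ 0 := by
  classical
  by_cases h : ∃ k, k ≠ 0 ∧ M.H j k ≠ 0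
  · unfold pivot
    cases hf : (List.finRange (M.cols + 1)).find? fun k => decide (k ≠ 0 ∧ M.H j k ≠ 0) with
    | none =>
      obtain ⟨k, hk⟩ := h
      exact absurd (decide_eq_true hk) (by simpa using List.find?_eq_none.1 hf k (by simp))
    | some k => simpa using List.find?_some hf
  -- If row `j` vanished outside the first column, it would be a multiple of the target vector.
  · exfalso
    push Not at h
    have hrow : M.H j = M.H j 0 • Pi.single 0 1 := by
      ext k
      by_cases hk : k = 0
      · subst hk; simp
      · simp [h k hk, hk]
    have hmem : M.ψ j ∈ M.participants := by simp [participants]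
    by_cases h0 : M.H j 0 = 0
    · obtain ⟨A, hyA, hA⟩ := hc _ hmem
      rw [h0, zero_smul] at hrow
      have hle : A.erase (M.ψ j) ∈ M.access := by
        refine ⟨(Finset.erase_subset _ _).trans hA.prop.1, ?_⟩
        refine Submodule.span_le.2 ?_ hA.prop.2
        rintro _ ⟨l, hl, rfl⟩
        by_cases e : l = j
        · rw [e, hrow]; exact Submodule.zero_mem _
        · exact Submodule.subset_span ⟨l, Finset.mem_erase.2 ⟨fun e' => e (hI e'), hl⟩, rfl⟩
      exact (Finset.mem_erase.1 (hA.2 hle (Finset.erase_subset _ _) hyA)).1 rfl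
    -- A nonzero multiple of the target spans it, so `{ψ j}` would be authorized.
    · refine hj ⟨by simpa using hmem, ?_⟩
      have : (Pi.single 0 1 : Fin (M.cols + 1) → ZMod p) = (M.H j 0)⁻¹ • M.H j := by
        rw [hrow, smul_smul]
        simp [h0]
      rw [this]
      exact Submodule.smul_mem _ _ (Submodule.subset_span ⟨j, by simp, rfl⟩)

/-- Injectivity matters: otherwise a remaining row could still carry the label `ψ j`. -/
theorem participants_contract (hI : M.Ideal) :
    (M.contract j).participants = M.participants \ {M.ψ j} := by
  ext x
  simp only [participants, Finset.mem_image, Finset.mem_univ, true_and, Finset.mem_sdiff,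
    Finset.mem_singleton]
  constructor
  · rintro ⟨l, rfl⟩
    exact ⟨⟨_, rfl⟩, fun e => skip_ne j l (hI e)⟩
  · rintro ⟨⟨l, rfl⟩, h⟩
    have hl : l ≠ j := fun e => h (by rw [e])
    exact ⟨unskip j l hl, by simp only [contract, skip_unskip]⟩

/-- What is authorized in the contracted scheme is authorized in the contracted access structure. -/
theorem mem_contraction {A : Finset (Fin n)} (hI : M.Ideal) (hA : A ∈ (M.contract j).access) :
    A ∈ contraction M.access {M.ψ j} := by
  obtain ⟨h1, h2⟩ := hA
  rw [participants_contract hI] at h1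
  refine ⟨Finset.disjoint_singleton_right.2 fun h => by simpa using h1 h, ?_, ?_⟩
  · refine Finset.union_subset (h1.trans Finset.sdiff_subset) ?_
    simp [participants]
  · refine Submodule.span_le.2 ?_ h2
    rintro _ ⟨l, hl, rfl⟩
    exact Submodule.sub_mem _ (Submodule.subset_span ⟨_, Finset.mem_union_left _ hl, rfl⟩)
      (Submodule.smul_mem _ _ (Submodule.subset_span ⟨j, by simp, rfl⟩))

/-- This elimination is what makes the entry of `v` in the pivot column irrelevant for the
contracted shares. -/
theorem contract_apply_pivot (h : M.H j (M.pivot j) ≠ 0) (l : Fin (M.rows - 1)) :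
    (M.contract j).H l (M.pivot j) = 0 := by
  simp [contract, coeff, h]

end LSSS

/-! ### The distribution of reconstructed ciphertexts -/

/-- Insert a value at `j`. -/
def glue {α : Type} {m : ℕ} (j : Fin m) (x : α) (r : Fin (m - 1) → α) (l : Fin m) : α :=
  if h : l = j then x else r (unskip j l h)

@[simp] theorem glue_self {α : Type} {m : ℕ} (j : Fin m) (x : α) (r : Fin (m - 1) → α) :
    glue j x r j = x := dif_pos rfl

@[simp] theorem glue_skip {α : Type} {m : ℕ} (j : Fin m) (x : α) (r : Fin (m - 1) → α)
    (l : Fin (m - 1)) : glue j x r (LSSS.skip j l) = r l := by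
  rw [glue, dif_neg (skip_ne j l), unskip_skip]

/-- Uniform exponents for all rows are the same as an independent uniform `ρ` for row `j` and
uniform exponents for the contracted scheme. -/
theorem glue_bijective {α : Type} {m : ℕ} (j : Fin m) :
    Function.Bijective fun x : α × (Fin (m - 1) → α) => glue j x.1 x.2 := by
  constructor
  · rintro ⟨x, r⟩ ⟨y, s⟩ h
    have h1 := congrFun h j
    have h2 := fun l => congrFun h (LSSS.skip j l)
    simp only [glue_self, glue_skip] at h1 h2
    rw [h1, funext h2]
  · intro r
    refine ⟨(r j, fun l => r (LSSS.skip j l)), ?_⟩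
    ext l
    by_cases h : l = j
    · subst h; simp
    · simp [glue, h, skip_unskip]

section distribution

variable {B : BilinearGenerator} {i : B.ι} {n : ℕ} {M : LSSS (B.p i) n} {j : Fin M.rows}

/-- The vector that differs from `v` at the pivot of row `j` only, and gives that row the
share `w`. -/
def adjust (M : LSSS (B.p i) n) (j : Fin M.rows) (w : ZMod (B.p i))
    (v : Fin (M.cols + 1) → ZMod (B.p i)) : Fin (M.cols + 1) → ZMod (B.p i) :=
  v + Pi.single (M.pivot j) ((w - M.H j ⬝ᵥ v) / M.H j (M.pivot j))

theorem share_adjust (h : M.H j (M.pivot j) ≠ 0) (w : ZMod (B.p i))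
    (v : Fin (M.cols + 1) → ZMod (B.p i)) : M.H j ⬝ᵥ adjust M j w v = w := by
  rw [adjust, dotProduct_add, dotProduct_single, mul_div_cancel₀ _ h, add_sub_cancel]

theorem dotProduct_adjust {u : Fin (M.cols + 1) → ZMod (B.p i)} (h : u (M.pivot j) = 0)
    (w : ZMod (B.p i)) (v : Fin (M.cols + 1) → ZMod (B.p i)) : u ⬝ᵥ adjust M j w v = u ⬝ᵥ v := by
  rw [adjust, dotProduct_add, dotProduct_single, h, zero_mul, add_zero]

theorem contract_share_adjust (h : M.H j (M.pivot j) ≠ 0) (w : ZMod (B.p i))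
    (v : Fin (M.cols + 1) → ZMod (B.p i)) (l : Fin (M.rows - 1)) :
    (M.contract j).H l ⬝ᵥ adjust M j w v = (M.contract j).H l ⬝ᵥ v :=
  dotProduct_adjust (LSSS.contract_apply_pivot h l) w v

/-- Each old row is the contracted row plus its coefficient times `h_j`; the contracted part does
not notice the adjustment, and `h_j` pairs to `w`. -/
theorem share_skip (h : M.H j (M.pivot j) ≠ 0) (w : ZMod (B.p i))
    (v : Fin (M.cols + 1) → ZMod (B.p i)) (l : Fin (M.rows - 1)) :
    M.H (LSSS.skip j l) ⬝ᵥ adjust M j w v =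
      (M.contract j).H l ⬝ᵥ v + w * M.coeff j (LSSS.skip j l) := by
  rw [← contract_share_adjust h w v l]
  change _ = (M.H (LSSS.skip j l) - M.coeff j (LSSS.skip j l) • M.H j) ⬝ᵥ adjust M j w v + _
  rw [sub_dotProduct, smul_dotProduct, share_adjust h, smul_eq_mul]
  ring

/-- For fixed randomness the reconstruction is an exact encryption under `M`; only the random
choices are renamed. -/
theorem reconstruct_encryptWith (pk : PublicKey B i n) (m : B.GT i) (h0 : M.pivot j ≠ 0)
    (h : M.H j (M.pivot j) ≠ 0) (w ρ : ZMod (B.p i)) (v : Fin (M.cols + 1) → ZMod (B.p i))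
    (r : Fin (M.rows - 1) → ZMod (B.p i)) :
    reconstruct pk j w ρ (encryptWith pk m (M.contract j) v r) =
      encryptWith pk m M (adjust M j w v) (glue j ρ r) := by
  -- The pivot is not the first column, so the secret, and with it `C` and `C'`, is untouched.
  have hv : adjust M j w v 0 = v 0 := by simp [adjust, h0.symm]
  simp only [reconstruct, encryptWith, Ciphertext.mk.injEq, hv]
  refine ⟨rfl, rfl, funext fun l => ?_, funext fun l => ?_⟩
  · by_cases e : l = j
    · subst e
      simp [share_adjust h]
    · obtain ⟨l, rfl⟩ : ∃ l', l = LSSS.skip j l' := ⟨_, (skip_unskip j l e).symm⟩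
      rw [dif_neg e, glue_skip, unskip_skip, share_skip h, pw_add (B.card_G i)]
      simp only [LSSS.contract]
      exact mul_right_comm _ _ _
  · by_cases e : l = j
    · subst e; simp
    · simp [glue, e]

/-- The factor `T ^ ρ` cancels the mask of row `j` and leaves `g ^ (a w)`, whose power removes the
term `w * coeff` from each share. Hence the ciphertext that the reduction holds is the contraction
of the one it rebuilds. -/
theorem contractCT_encryptWith (pk : PublicKey B i n) (m : B.GT i) (h0 : M.pivot j ≠ 0)
    (h : M.H j (M.pivot j) ≠ 0) (w ρ : ZMod (B.p i)) (v : Fin (M.cols + 1) → ZMod (B.p i))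
    (r : Fin (M.rows - 1) → ZMod (B.p i)) :
    contractCT pk (encryptWith pk m M (adjust M j w v) (glue j ρ r)) j ρ =
      encryptWith pk m (M.contract j) v r := by
  have hv : adjust M j w v 0 = v 0 := by simp [adjust, h0.symm]
  have hc := B.card_G i
  have hT : pw (pk.T (M.ψ j)) (-ρ) * pw (pk.T (M.ψ j)) ρ = 1 := by
    rw [← pw_add hc, neg_add_cancel, pw_zero]
  simp only [contractCT, encryptWith, Ciphertext.mk.injEq, hv]
  refine ⟨rfl, rfl, funext fun l : Fin (M.rows - 1) => ?_,
    funext fun l : Fin (M.rows - 1) => by rw [glue_skip]⟩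
  rw [glue_self, glue_skip, share_skip h, share_adjust h, pw_add hc,
    mul_assoc (pw pk.ga w), hT, mul_one,
    ← pw_mul hc, mul_neg, pw_neg hc pk.ga, mul_right_comm,
    mul_assoc _ (pw pk.ga _), mul_inv_cancel, mul_one]
  rfl

/-- For fixed `v` the correction at the pivot is an affine bijection of `w`, hence uniform whatever
`v` is; and a translate of a uniform vector is uniform. -/
theorem uniform_adjust {δ : Type} (h : M.H j (M.pivot j) ≠ 0)
    (F : (Fin (M.cols + 1) → ZMod (B.p i)) → PMF δ) :
    ((PMF.uniformOfFintype (ZMod (B.p i))).bind fun w =>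
      (PMF.uniformOfFintype (Fin (M.cols + 1) → ZMod (B.p i))).bind fun v => F (adjust M j w v)) =
      (PMF.uniformOfFintype _).bind F := by
  have h1 : ∀ v, ((PMF.uniformOfFintype (ZMod (B.p i))).bind fun w => F (adjust M j w v)) =
      (PMF.uniformOfFintype (ZMod (B.p i))).bind fun u => F (v + Pi.single (M.pivot j) u) :=
    fun v => uniformOfFintype_bind (f := fun w => (w - M.H j ⬝ᵥ v) / M.H j (M.pivot j))
      ((Equiv.subRight _).trans (Equiv.divRight₀ _ h)).bijective
      fun u => F (v + Pi.single (M.pivot j) u)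
  have h2 : ∀ u, ((PMF.uniformOfFintype (Fin (M.cols + 1) → ZMod (B.p i))).bind fun v =>
      F (v + Pi.single (M.pivot j) u)) = (PMF.uniformOfFintype _).bind F := fun u => by
    have hb : Function.Bijective fun v : Fin (M.cols + 1) → ZMod (B.p i) =>
        v + Pi.single (M.pivot j) u := AddGroup.addRight_bijective _
    exact uniformOfFintype_bind hb F
  rw [PMF.bind_comm]
  simp only [h1]
  rw [PMF.bind_comm]
  simp only [h2, PMF.bind_const]

/-- The reply to the challenge, reconstructed from a ciphertext under the contracted policy, has the
right distribution. -/
theorem reconstruct_distribution (pk : PublicKey B i n) (m : B.GT i) (h0 : M.pivot j ≠ 0)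
    (h : M.H j (M.pivot j) ≠ 0) :
    ((PMF.uniformOfFintype (ZMod (B.p i))).bind fun w =>
      (PMF.uniformOfFintype (ZMod (B.p i))).bind fun ρ =>
        (encrypt pk m (M.contract j)).map fun ct => (reconstruct pk j w ρ ct, ct, ρ)) =
      (encryptStar pk m M).map fun x => (x.1, contractCT pk x.1 j (x.2 j), x.2 j) := by
  -- Both sides are written as laws of the same function of the vector and the exponents, so that
  -- only their distributions remain to be compared.
  let F : (Fin (M.cols + 1) → ZMod (B.p i)) → (Fin M.rows → ZMod (B.p i)) →
      Ciphertext B i M × Ciphertext B i (M.contract j) × ZMod (B.p i) := fun v r =>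
    (encryptWith pk m M v r, contractCT pk (encryptWith pk m M v r) j (r j), r j)
  have hR : (encryptStar pk m M).map (fun x => (x.1, contractCT pk x.1 j (x.2 j), x.2 j)) =
      (PMF.uniformOfFintype _).bind fun v => (PMF.uniformOfFintype _).map (F v) := by
    rw [encryptStar, PMF.map_bind]
    simp only [PMF.map_comp]
    rfl
  have hL : ∀ w ρ, ((encrypt pk m (M.contract j)).map fun ct => (reconstruct pk j w ρ ct, ct, ρ)) =
      (PMF.uniformOfFintype (Fin (M.cols + 1) → ZMod (B.p i))).bind fun v =>
        (PMF.uniformOfFintype (Fin (M.rows - 1) → ZMod (B.p i))).map fun r =>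
          F (adjust M j w v) (glue j ρ r) := by
    intro w ρ
    rw [encrypt, PMF.map_bind]
    simp only [PMF.map_comp]
    refine congrArg _ (funext fun v => congrArg (fun f => PMF.map f _) (funext fun r => ?_))
    have e : glue j ρ r j = ρ := glue_self j ρ r
    exact Prod.ext (reconstruct_encryptWith pk m h0 h w ρ v r) (Prod.ext
      ((contractCT_encryptWith pk m h0 h w ρ v r).symm.trans (congrArg (contractCT pk _ j) e.symm))
      e.symm)
  have hG : ∀ v, ((PMF.uniformOfFintype (ZMod (B.p i))).bind fun ρ =>
      (PMF.uniformOfFintype (Fin (M.rows - 1) → ZMod (B.p i))).map fun r => F v (glue j ρ r)) =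
      (PMF.uniformOfFintype _).map (F v) := by
    intro v
    rw [← uniformOfFintype_bind_map (glue_bijective j), PMF.map_bind]
    simp only [PMF.map_comp]
    rfl
  rw [hR, ← uniform_adjust h]
  refine congrArg _ (funext fun w => ?_)
  simp only [hL]
  rw [PMF.bind_comm]
  simp only [hG]

end distribution

/-- Adding `0` forces an arbitrary datum to be a leaf. -/
theorem Cmp.value {ι : Type} {K : ι → ℕ} {X Y : ι → Data} (h : Cmp K X Y) :
    Cmp K X fun a => num (Y a).val :=
  (h.cons (.lit h.left 0)).op .add

/-! ### The transitions of the reduction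

The memory of the reduction starts with a tag: it is in its initial state (`0`), has asked for the
first (`1`) or second (`2`) random number, or is simulating (`3`). -/

/-- What the reduction knows when it starts the simulation. -/
structure Ctx (B : BilinearGenerator) where
  i : B.ι
  n : ℕ
  z : Data
  pk : PublicKey B i n
  w : ZMod (B.p i)
  ρ : ZMod (B.p i)

namespace Ctx

variable {B : BilinearGenerator} (c : Ctx B)

/-- The first message received. -/
def start : Data := .cons c.z (encPK c.pk)

def env : Data := .cons c.start (.cons (encZ c.w) (encZ c.ρ))

/-- The first state of the simulation. -/
def state (mem pending : Data) : Data := .cons (.num 3) (.cons c.env (.cons mem pending))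

/-- The reply to the challenge of the simulated adversary. -/
def reply {M : LSSS (B.p c.i) c.n} (j : Fin M.rows) (ct : Ciphertext B c.i (M.contract j)) : Data :=
  .ofList [encCT (reconstruct c.pk j c.w c.ρ ct), encCT ct, encZ c.ρ]

/-- The input of the simulated adversary for each input of the reduction. -/
inductive Input : Data → Data → Prop
  | start : Input (.cons (.cons (.num 2) (.cons c.start (encZ c.w))) (encZ c.ρ))
      (.cons (.num 0) c.start)
  | forward (mem inbox : Data) :
      Input (.cons (c.state mem (.num 0)) inbox) (.cons mem inbox)
  | reply (mem : Data) (M : LSSS (B.p c.i) c.n) (j : Fin M.rows) (hI : M.Ideal)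
      (ct : Ciphertext B c.i (M.contract j)) :
      Input (.cons (c.state mem (.cons (encLSSS M) (encAttr (M.ψ j)))) (encCT ct))
        (.cons mem (c.reply j ct))

/-- The output of the reduction for each output of the simulated adversary. -/
inductive Output (out : Data) : Data → Prop
  | forward (h : out.tail.head ≠ .num 2) :
      Output out (.cons (c.state out.head (.num 0)) out.tail)
  | challenge (m₀ m₁ : B.GT c.i) (M : LSSS (B.p c.i) c.n) (j : Fin M.rows) (hI : M.Ideal)
      (h : out.tail = .cons (.num 2)
        (.ofList [B.encGT c.i m₀, B.encGT c.i m₁, encLSSS M, encAttr (M.ψ j)])) :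
      Output out (.cons (c.state out.head (.cons (encLSSS M) (encAttr (M.ψ j))))
        (.cons (.num 2) (.ofList [B.encGT c.i m₀, B.encGT c.i m₁, encLSSS (M.contract j)])))

/-- The request for a random exponent. -/
def ask : Data := .cons (.num 0) (.num (B.p c.i - 1))

/-- The reduction from a given adversary, where `K` bounds the running time of that adversary. -/
inductive Transition (𝒜 : Adversary) (K : ℕ) : Data → Data → Prop
  | first : Transition 𝒜 K (.cons (.num 0) c.start) (.cons (.cons (.num 1) c.start) c.ask)
  | second : Transition 𝒜 K (.cons (.cons (.num 1) c.start) (encZ c.w))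
      (.cons (.cons (.num 2) (.cons c.start (encZ c.w))) c.ask)
  | simulate (x xA y : Data) (hx : c.Input x xA) (hy : c.Output (𝒜.step xA) y)
      (ht : 𝒜.time xA ≤ K) : Transition 𝒜 K x y

/-! ### Inversion of the transition relations by tests that a program can carry out -/

variable {c} {x y : Data}

theorem Input.tag (h : c.Input x y) : x.head.head = num 2 ∨ x.head.head = num 3 := by
  cases h <;> simp [state]

theorem Input.of_ne (h : c.Input x y) (hx : x.head.head ≠ num 3) :
    x = .cons (.cons (.num 2) (.cons c.start (encZ c.w))) (encZ c.ρ) ∧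
      y = .cons (.num 0) c.start := by
  cases h with
  | start => exact ⟨rfl, rfl⟩
  | forward => exact absurd rfl hx
  | reply => exact absurd rfl hx

/-- The last entry of the memory is a leaf unless a challenge awaits its answer; in that case it
stores the policy and the attribute. -/
theorem Input.of_leaf (h : c.Input x y) (hx : x.head.head = num 3)
    (hl : x.head.tail.tail.tail.isLeaf.val ≠ 0) :
    ∃ mem inbox, x = .cons (c.state mem (.num 0)) inbox ∧ y = .cons mem inbox := by
  cases h with
  | start => simp at hx
  | forward => exact ⟨_, _, rfl, rfl⟩
  | reply => exact absurd rfl hl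

theorem Input.of_not_leaf (h : c.Input x y) (hx : x.head.head = num 3)
    (hl : ¬x.head.tail.tail.tail.isLeaf.val ≠ 0) :
    ∃ (mem : Data) (M : LSSS (B.p c.i) c.n) (j : Fin M.rows) (ct : Ciphertext B c.i (M.contract j)),
      M.Ideal ∧ x = .cons (c.state mem (.cons (encLSSS M) (encAttr (M.ψ j)))) (encCT ct) ∧
        y = .cons mem (c.reply j ct) := by
  cases h with
  | start => simp at hx
  | forward => exact absurd Nat.one_ne_zero hl
  | reply mem M j hI ct => exact ⟨_, _, _, _, hI, rfl, rfl⟩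

theorem Output.of_ne (h : c.Output x y) (hx : x.tail.head ≠ num 2) :
    y = .cons (c.state x.head (.num 0)) x.tail := by
  cases h with
  | forward => rfl
  | challenge _ _ _ _ _ h => exact absurd (by rw [h]; rfl) hx

theorem Transition.of_simulate {𝒜 : Adversary} {K : ℕ} (h : c.Transition 𝒜 K x y)
    (hx : x.head.head.val - 1 ≠ 0) :
    ∃ xA, c.Input x xA ∧ c.Output (𝒜.step xA) y ∧ 𝒜.time xA ≤ K := by
  cases h with
  | first => exact absurd rfl hx
  | second => exact absurd rfl hx
  | simulate x xA y h1 h2 h3 => exact ⟨xA, h1, h2, h3⟩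

theorem Transition.of_not_simulate {𝒜 : Adversary} {K : ℕ} (h : c.Transition 𝒜 K x y)
    (hx : ¬x.head.head.val - 1 ≠ 0) :
    (x = .cons (.num 0) c.start ∧ y = .cons (.cons (.num 1) c.start) c.ask) ∨
      (x = .cons (.cons (.num 1) c.start) (encZ c.w) ∧
        y = .cons (.cons (.num 2) (.cons c.start (encZ c.w))) c.ask) := by
  cases h with
  | first => exact .inl ⟨rfl, rfl⟩
  | second => exact .inr ⟨rfl, rfl⟩
  | simulate x xA y h1 h2 h3 => rcases h1.tag with h | h <;> simp [h] at hx

theorem Output.of_eq (h : c.Output x y) (hx : x.tail.head = num 2) :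
    ∃ (m₀ m₁ : B.GT c.i) (M : LSSS (B.p c.i) c.n) (j : Fin M.rows), M.Ideal ∧
      x.tail = .cons (.num 2)
        (.ofList [B.encGT c.i m₀, B.encGT c.i m₁, encLSSS M, encAttr (M.ψ j)]) ∧
      y = .cons (c.state x.head (.cons (encLSSS M) (encAttr (M.ψ j))))
        (.cons (.num 2) (.ofList [B.encGT c.i m₀, B.encGT c.i m₁, encLSSS (M.contract j)])) := by
  cases h with
  | forward h => exact absurd hx h
  | challenge m₀ m₁ M j hI h => exact ⟨m₀, m₁, M, j, hI, h, rfl⟩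

end Ctx

/-! ### The transitions as a polynomial time program -/

section programs

variable {B : BilinearGenerator} {ι : Type} {K : ι → ℕ} {X : ι → Data} {c : ι → Ctx B}

/-- The context is carried along with the input of the simulated adversary, since the next state of
the reduction has to contain it. -/
theorem Cmp.simulatedInput (hX : PolyBdd K fun a => (X a).size)
    (hE : PolyBdd (fun z : Σ a, B.G (c a).i => K z.1) fun z => (B.encG (c z.1).i z.2).size)
    {xA : ι → Data} (h : ∀ a, (c a).Input (X a) (xA a)) :
    Cmp K X fun a => .cons (c a).env (xA a) := by
  have r := Cmp.refl hX
  refine cases_prop (p := fun a => (X a).head.head = num 3)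
    (Cmp.sub r.head.head.value (.lit hX 2)) (fun a => ?_) ?_ ?_
  · rcases (h a).tag with h | h <;> simp [h]
  · let κ := {a // (X a).head.head = num 3}
    have r' := r.reindex fun z : κ => z.1
    refine cases_prop (p := fun z : κ => (X z).head.tail.tail.tail.isLeaf.val ≠ 0)
      r'.head.tail.tail.tail.isLeaf.value (fun _ => Iff.rfl) ?_ ?_
    · have r'' := r'.reindex fun z : {z : κ // (X z).head.tail.tail.tail.isLeaf.val ≠ 0} => z.1
      choose mem inbox h1 h2 using fun z : {z : κ // (X z).head.tail.tail.tail.isLeaf.val ≠ 0} =>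
        (h z.1).of_leaf z.1.2 z.2
      refine (r''.head.tail.head.cons (r''.head.tail.tail.head.cons r''.tail)).congr fun z => ?_
      rw [h1, h2]
      rfl
    · let κ' := {z : κ // ¬(X z).head.tail.tail.tail.isLeaf.val ≠ 0}
      have r'' := r'.reindex fun z : κ' => z.1
      -- These witnesses are merely chosen; the program gets at them through their codes, which are
      -- parts of the input.
      choose mem M j ct hI h1 h2 using fun z : κ' => (h z.1).of_not_leaf z.1.2 z.2
      have henv : Cmp (fun z : κ' => K z.1) (fun z => X z.1) fun z => (c z.1).env :=
        r''.head.tail.head.congr fun z => by rw [h1]; rfl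
      have hmem : Cmp (fun z : κ' => K z.1) (fun z => X z.1) fun z => mem z :=
        r''.head.tail.tail.head.congr fun z => by rw [h1]; rfl
      have hM : Cmp (fun z : κ' => K z.1) (fun z => X z.1) fun z => encLSSS (M z) :=
        r''.head.tail.tail.tail.head.congr fun z => by rw [h1]; rfl
      have hy : Cmp (fun z : κ' => K z.1) (fun z => X z.1) fun z => encAttr ((M z).ψ (j z)) :=
        r''.head.tail.tail.tail.tail.congr fun z => by rw [h1]; rfl
      have hct : Cmp (fun z : κ' => K z.1) (fun z => X z.1) fun z => encCT (ct z) :=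
        r''.tail.congr fun z => by rw [h1]; rfl
      have hρ : Cmp (fun z : κ' => K z.1) (fun z => X z.1) fun z => encZ (c z.1).ρ := henv.tail.tail
      have hE' : PolyBdd (fun z : Σ a : κ', B.G (c a.1).i => K z.1.1)
        fun z => (B.encG (c z.1.1).i z.2).size :=
          hE.reindex fun z : (Σ a : κ', B.G (c a.1).i) => ⟨z.1.1, z.2⟩
      have hrec := Cmp.reconstruct hE' henv.head.tail hM (rowIndex hM hI hy) henv.tail.head hρ hct
      refine (henv.cons (hmem.cons (hrec.cons (hct.cons (hρ.cons (.lit henv.left 0)))))).congr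
        fun z => ?_
      rw [h2]
      rfl
  · have r' := r.reindex fun z : {a // ¬ (X a).head.head = num 3} => z.1
    refine ((r'.head.tail.head.cons (r'.head.tail.tail.cons r'.tail)).cons
      ((Cmp.lit r'.left 0).cons r'.head.tail.head)).congr fun z => ?_
    rw [((h z).of_ne z.2).1, ((h z).of_ne z.2).2]
    rfl

theorem Cmp.simulatedOutput {out Y : ι → Data} (henv : Cmp K X fun a => (c a).env)
    (hout : Cmp K X out) (h : ∀ a, (c a).Output (out a) (Y a)) : Cmp K X Y := by
  have hW := hout.tail.head.isLeaf.value
  have hV := hout.tail.head.value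
  have key : ∀ a, (out a).tail.head = num 2 ↔ (out a).tail.head.isLeaf.val *
      (1 - (((out a).tail.head.val - 2) + (2 - (out a).tail.head.val))) ≠ 0 := fun a => by
    cases (out a).tail.head with
    | num n => simp only [isLeaf_num, val_num, num.injEq]; omega
    | cons u v => simp
  refine cases_prop (p := fun a => (out a).tail.head = num 2)
    (Cmp.mul hW (Cmp.eq_test hV (.lit hout.left 2))) key ?_ ?_
  · let κ := {a // (out a).tail.head = num 2}
    choose m₀ m₁ M j hI h1 h2 using fun z : κ => (h z.1).of_eq z.2
    have ho := hout.reindex fun z : κ => z.1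
    have he := henv.reindex fun z : κ => z.1
    have hM : Cmp (fun z : κ => K z.1) (fun z => X z.1) fun z => encLSSS (M z) :=
      ho.tail.tail.tail.tail.head.congr fun z => by rw [h1]; rfl
    have hy : Cmp (fun z : κ => K z.1) (fun z => X z.1) fun z => encAttr ((M z).ψ (j z)) :=
      ho.tail.tail.tail.tail.tail.head.congr fun z => by rw [h1]; rfl
    have hp : Cmp (fun z : κ => K z.1) (fun z => X z.1) fun z => num (B.p (c z.1).i) :=
      he.head.tail.head
    have hc := Cmp.contract hp hM (rowIndex hM hI hy)
    have h0 := Cmp.lit ho.left 0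
    refine (((Cmp.lit ho.left 3).cons (he.cons (ho.head.cons (hM.cons hy)))).cons
      ((Cmp.lit ho.left 2).cons (ho.tail.tail.head.cons (ho.tail.tail.tail.head.cons
        (hc.cons h0))))).congr fun z => ?_
    rw [h2, h1]
    rfl
  · let κ := {a // ¬(out a).tail.head = num 2}
    have ho := hout.reindex fun z : κ => z.1
    have he := henv.reindex fun z : κ => z.1
    refine (((Cmp.lit ho.left 3).cons (he.cons (ho.head.cons (.lit ho.left 0)))).cons
      ho.tail).congr fun z => ?_
    rw [(h z.1).of_ne z.2]
    rfl

theorem Cmp.transition {𝒜 : Adversary} {Y : ι → Data} (hX : PolyBdd K fun a => (X a).size)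
    (hE : PolyBdd (fun z : Σ a, B.G (c a).i => K z.1) fun z => (B.encG (c z.1).i z.2).size)
    (h : ∀ a, (c a).Transition 𝒜 (K a) (X a) (Y a)) : Cmp K X Y := by
  have r := Cmp.refl hX
  have hp : Cmp K X fun a => num (X a).head.head.val := r.head.head.value
  -- Tags `2` and `3` lead to a step of the simulated adversary, tags `0` and `1` to a request for
  -- randomness.
  refine cases_prop (p := fun a => (X a).head.head.val - 1 ≠ 0) (hp.sub (.lit hX 1))
    (fun _ => Iff.rfl) ?_ ?_
  · let κ := {a // (X a).head.head.val - 1 ≠ 0}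
    choose xA hx hy ht using fun z : κ => (h z.1).of_simulate z.2
    have hE' : PolyBdd (fun z : Σ a : κ, B.G (c a).i => K z.1) fun z =>
      (B.encG (c z.1).i z.2).size :=
        hE.reindex fun z : (Σ a : κ, B.G (c a).i) => ⟨z.1, z.2⟩
    have hin := Cmp.simulatedInput (hX.reindex fun z : κ => z.1) hE' hx
    -- The adversary's own program is a subroutine, whose running time is bounded by `K` by
    -- definition of a transition.
    exact Cmp.simulatedOutput hin.head (hin.tail.trans ⟨𝒜.code, fun x => ⟨_, _, 𝒜.runs x⟩,
      fun z => 𝒜.time (xA z), fun z => 𝒜.runs _, .of_le ht⟩) hy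
  · let κ := {a // ¬(X a).head.head.val - 1 ≠ 0}
    have r' := r.reindex fun z : κ => z.1
    have one := Cmp.lit r'.left 1
    -- The order `p` stands first in the public key; asking for `p - 1` gives a number uniform in
    -- `{0, …, p - 1}`.
    have ask : ∀ {S : κ → Data}, Cmp (fun z : κ => K z.1) (fun z => X z.1) S →
        Cmp (fun z : κ => K z.1) (fun z => X z.1)
          fun z => .cons (.num 0) (.num ((S z).tail.head.val - 1)) := fun hS =>
      (Cmp.lit r'.left 0).cons (hS.tail.head.value.sub one)
    refine (r'.head.head.value.ite
      (((Cmp.lit r'.left 2).cons (r'.head.tail.cons r'.tail)).cons (ask r'.head.tail))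
      ((one.cons r'.tail).cons (ask r'.tail))
      (p := fun z : κ => (X z).head.head.val ≠ 0) fun _ => Iff.rfl).congr fun z => ?_
    rcases (h z.1).of_not_simulate z.2 with ⟨h1, h2⟩ | ⟨h1, h2⟩
    · rw [h1, h2]; rfl
    · rw [h1, h2]; rfl

end programs

/-- The family is indexed by all transitions in all contexts and for all bounds at once, so a single
program and a single polynomial serve them. The bound `K` is a free parameter because the simulated
adversary is not assumed to be fast on every input. -/
theorem exists_reduction (B : BilinearGenerator) (𝒜 : Adversary) :
    ∃ (code : Code) (step : Data → Data) (time : Data → ℕ) (Q : Polynomial ℕ),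
      (∀ x, Runs code x (step x) (time x)) ∧
      ∀ (c : Ctx B) (K : ℕ) (x y : Data), c.Transition 𝒜 K x y → x.size ≤ K →
        (∀ u, (B.encG c.i u).size ≤ K) → step x = y ∧ time x ≤ Q.eval K := by
  let κ := {r : Ctx B × ℕ × Data × Data // r.1.Transition 𝒜 r.2.1 r.2.2.1 r.2.2.2 ∧
    r.2.2.1.size ≤ r.2.1 ∧ ∀ u, (B.encG r.1.i u).size ≤ r.2.1}
  obtain ⟨code, hc, t, ht, Q, hQ⟩ := Cmp.transition (ι := κ) (K := fun r => r.1.2.1)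
    (X := fun r => r.1.2.2.1) (c := fun r => r.1.1) (Y := fun r => r.1.2.2.2) (𝒜 := 𝒜)
    (.of_le fun r => r.2.2.1) (.of_le fun z => z.1.2.2.2 z.2) fun r => r.2.1
  choose step time hr using hc
  refine ⟨code, step, time, Q, hr, fun c K x y h1 h2 h3 => ?_⟩
  obtain ⟨e1, e2⟩ := (hr x).unique (ht ⟨(c, K, x, y), h1, h2, h3⟩)
  exact ⟨e1, e2 ▸ hQ ⟨(c, K, x, y), h1, h2, h3⟩⟩

/-! ### Requests are determined by their representation -/

theorem Data.ofList_injective : Function.Injective ofList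
  | [], [], _ => rfl
  | [], _ :: _, h => by simp [ofList] at h
  | _ :: _, [], h => by simp [ofList] at h
  | x :: xs, y :: ys, h => by
    simp only [ofList, Data.cons.injEq] at h
    rw [h.1, ofList_injective h.2]

theorem encFam_injective {l l' : ℕ} {f : Fin l → Data} {g : Fin l' → Data}
    (h : encFam f = encFam g) : (⟨l, f⟩ : Σ l, Fin l → Data) = ⟨l', g⟩ :=
  List.ofFn_inj'.1 (ofList_injective h)

theorem encAttr_injective {n : ℕ} : Function.Injective (encAttr (n := n)) :=
  fun _ _ h => Fin.ext (num.inj h)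

theorem encZ_injective {p : ℕ} [NeZero p] : Function.Injective (encZ (p := p)) :=
  fun _ _ h => ZMod.val_injective p (num.inj h)

theorem encSet_injective {n : ℕ} : Function.Injective (encSet (n := n)) := fun A A' h => by
  have := encAttr_injective.list_map (ofList_injective h)
  rw [← A.sort_toFinset (· ≤ ·), this, A'.sort_toFinset]

theorem encLSSS_injective {p n : ℕ} [NeZero p] :
    Function.Injective (encLSSS (p := p) (n := n)) := by
  rintro ⟨r, d, H, ψ⟩ ⟨r', d', H', ψ'⟩ h
  simp only [encLSSS, Data.cons.injEq, num.injEq] at h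
  obtain ⟨rfl, h⟩ := h
  have h' := encFam_injective h
  obtain ⟨rfl, h''⟩ := Sigma.mk.inj h'
  have key := fun l => congrFun (eq_of_heq h'') l
  simp only [Data.cons.injEq] at key
  have h1 : ψ = ψ' := funext fun l => encAttr_injective (key l).1
  have h2 : H = H' := by
    funext l c
    exact encZ_injective (congrFun (eq_of_heq (Sigma.mk.inj (encFam_injective (key l).2)).2) c)
  rw [h1, h2]

/-- The challenger decodes with a partial inverse; injectivity ensures that it understands the
requests of the reduction as they are meant. -/
theorem Request.enc_injective {n : ℕ} {Chal : Type} {encChal : Chal → Data}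
    (h : Function.Injective encChal) : Function.Injective (Request.enc (n := n) encChal) := by
  intro r r' e
  cases r <;> cases r' <;> simp only [Request.enc, Data.cons.injEq, num.injEq, true_and] at e <;>
    first | omega | skip
  · rw [e]
  · rw [encSet_injective e]
  · rw [h e]
  · rename_i b b'; cases b <;> cases b' <;> simp_all

/-- This direction needs no injectivity, and it suffices for the requests of the simulated
adversary. -/
theorem eq_of_partialInv_eq_some {α β : Type} {f : α → β} {x : β} {a : α}
    (h : Function.partialInv f x = some a) : f a = x := by
  unfold Function.partialInv at h
  split_ifs at h with hx
  exact Option.some.inj h ▸ hx.choose_spec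

/-! ### Rounds of a game -/

section rounds

variable {n : ℕ} {C : Challenger n} {𝒜 : Adversary} {s : Config C}

/-- The request made in a round. -/
def Config.request (𝒜 : Adversary) (s : Config C) : Option (Request n C.Chal) :=
  Function.partialInv (Request.enc (n := n) C.encChal) (𝒜.step (.cons s.memory s.inbox)).tail

/-- The configuration after the adversary has moved. -/
def Config.advance (𝒜 : Adversary) (s : Config C) : Config C :=
  { s with
    memory := (𝒜.step (.cons s.memory s.inbox)).head
    time := s.time + 𝒜.time (.cons s.memory s.inbox) }

theorem playRound_of_halted (h : s.guess.isSome ∨ s.failed) : playRound 𝒜 C s = PMF.pure s := by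
  rw [playRound, if_pos (by simpa using h)]

theorem playRounds_of_halted (h : s.guess.isSome ∨ s.failed) (N : ℕ) :
    playRounds 𝒜 C N s = PMF.pure s := by
  induction N with
  | zero => rfl
  | succ N ih => rw [playRounds, playRound_of_halted h, PMF.pure_bind, ih]

variable (hg : s.guess = none) (hf : s.failed = false)
include hg hf

theorem playRound_none (h : s.request 𝒜 = none) :
    playRound 𝒜 C s = PMF.pure { s.advance 𝒜 with failed := true } := by
  rw [Config.request] at h
  simp [playRound, hg, hf, h, Config.advance]

theorem playRound_sample {m : ℕ} (h : s.request 𝒜 = some (.sample m)) :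
    playRound 𝒜 C s = (PMF.uniformOfFintype (Fin (m + 1))).map
      fun r => { s.advance 𝒜 with inbox := .num r.val } := by
  rw [Config.request] at h
  simp [playRound, hg, hf, h, Config.advance]

theorem playRound_key {S : Finset (Fin n)} (h : s.request 𝒜 = some (.key S)) :
    playRound 𝒜 C s = (C.keyReply S).map
      fun x => { s.advance 𝒜 with inbox := x, queries := S :: s.queries } := by
  rw [Config.request] at h
  simp [playRound, hg, hf, h, Config.advance]

theorem playRound_challenge {c : C.Chal} (h : s.request 𝒜 = some (.challenge c))
    (hc : s.chal = none) : playRound 𝒜 C s = (C.chalReply c).map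
      fun x => { s.advance 𝒜 with inbox := x, chal := some c } := by
  rw [Config.request] at h
  simp [playRound, hg, hf, h, Config.advance, hc]

theorem playRound_challenge_of_isSome {c : C.Chal} (h : s.request 𝒜 = some (.challenge c))
    (hc : s.chal.isSome) : playRound 𝒜 C s = PMF.pure { s.advance 𝒜 with failed := true } := by
  rw [Config.request] at h
  simp [playRound, hg, hf, h, Config.advance, hc]

theorem playRound_guess {b : Bool} (h : s.request 𝒜 = some (.guess b)) :
    playRound 𝒜 C s = PMF.pure { s.advance 𝒜 with guess := some b } := by
  rw [Config.request] at h
  simp [playRound, hg, hf, h, Config.advance]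

end rounds

/-- The part of a configuration that is never taken back. -/
structure Config.Le {n : ℕ} {C : Challenger n} (s t : Config C) : Prop where
  time : s.time ≤ t.time
  chal : ∀ c, s.chal = some c → t.chal = some c
  failed : s.failed → t.failed

section rounds

variable {n : ℕ} {C : Challenger n} {𝒜 : Adversary} {s t : Config C}

theorem Config.Le.refl (s : Config C) : s.Le s := ⟨le_rfl, fun _ h => h, fun h => h⟩

theorem Config.Le.trans {u : Config C} (h : s.Le t) (h' : t.Le u) : s.Le u :=
  ⟨h.time.trans h'.time, fun c hc => h'.chal c (h.chal c hc), fun hf => h'.failed (h.failed hf)⟩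

theorem le_of_mem_playRound (ht : t ∈ (playRound 𝒜 C s).support) : s.Le t := by
  by_cases hh : s.guess.isSome ∨ s.failed
  · rw [playRound_of_halted hh, PMF.mem_support_pure_iff] at ht
    exact ht ▸ .refl s
  · obtain ⟨hg, hf⟩ : s.guess = none ∧ s.failed = false := by simpa using hh
    have ha : s.time ≤ (s.advance 𝒜).time := Nat.le_add_right _ _
    cases hr : s.request 𝒜 with
    | none =>
      rw [playRound_none hg hf hr, PMF.mem_support_pure_iff] at ht
      exact ht ▸ ⟨ha, fun _ h => h, fun _ => rfl⟩
    | some r =>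
      cases r with
      | sample m =>
        rw [playRound_sample hg hf hr, PMF.mem_support_map_iff] at ht
        obtain ⟨x, -, rfl⟩ := ht
        exact ⟨ha, fun _ h => h, fun h => h⟩
      | key S =>
        rw [playRound_key hg hf hr, PMF.mem_support_map_iff] at ht
        obtain ⟨x, -, rfl⟩ := ht
        exact ⟨ha, fun _ h => h, fun h => h⟩
      | challenge c =>
        cases hc : s.chal with
        | none =>
          rw [playRound_challenge hg hf hr hc, PMF.mem_support_map_iff] at ht
          obtain ⟨x, -, rfl⟩ := ht
          exact ⟨ha, fun _ h => by simp [hc] at h, fun h => h⟩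
        | some c' =>
          rw [playRound_challenge_of_isSome hg hf hr (by simp [hc]), PMF.mem_support_pure_iff] at ht
          exact ht ▸ ⟨ha, fun _ h => h, fun _ => rfl⟩
      | guess b =>
        rw [playRound_guess hg hf hr, PMF.mem_support_pure_iff] at ht
        exact ht ▸ ⟨ha, fun _ h => h, fun h => h⟩

theorem time_eq_of_mem_playRound (hg : s.guess = none) (hf : s.failed = false)
    (ht : t ∈ (playRound 𝒜 C s).support) : t.time = (s.advance 𝒜).time := by
  cases hr : s.request 𝒜 with
  | none =>
    rw [playRound_none hg hf hr, PMF.mem_support_pure_iff] at ht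
    exact ht ▸ rfl
  | some r =>
    cases r with
    | sample m =>
      rw [playRound_sample hg hf hr, PMF.mem_support_map_iff] at ht
      obtain ⟨x, -, rfl⟩ := ht; rfl
    | key S =>
      rw [playRound_key hg hf hr, PMF.mem_support_map_iff] at ht
      obtain ⟨x, -, rfl⟩ := ht; rfl
    | challenge c =>
      cases hc : s.chal with
      | none =>
        rw [playRound_challenge hg hf hr hc, PMF.mem_support_map_iff] at ht
        obtain ⟨x, -, rfl⟩ := ht; rfl
      | some c' =>
        rw [playRound_challenge_of_isSome hg hf hr (by simp [hc]), PMF.mem_support_pure_iff] at ht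
        exact ht ▸ rfl
    | guess b =>
      rw [playRound_guess hg hf hr, PMF.mem_support_pure_iff] at ht
      exact ht ▸ rfl

theorem le_of_mem_playRounds {N : ℕ} (ht : t ∈ (playRounds 𝒜 C N s).support) : s.Le t := by
  induction N generalizing s with
  | zero => rw [playRounds, PMF.mem_support_pure_iff] at ht; exact ht ▸ .refl s
  | succ N ih =>
    rw [playRounds, PMF.mem_support_bind_iff] at ht
    obtain ⟨u, hu, ht⟩ := ht
    exact (le_of_mem_playRound hu).trans (ih ht)

/-- All runs from a configuration are legal. -/
def LegalFrom (𝒜 : Adversary) (k N : ℕ) (s : Config C) : Prop :=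
  ∀ t ∈ (playRounds 𝒜 C N s).support, LegalRun 𝒜 k t

variable {k N : ℕ}

theorem LegalFrom.next (h : LegalFrom 𝒜 k (N + 1) s) (ht : t ∈ (playRound 𝒜 C s).support) :
    LegalFrom 𝒜 k N t :=
  fun _ hu => h _ ((PMF.mem_support_bind_iff _ _ _).2 ⟨_, ht, hu⟩)

/-- Legality only concerns final configurations, but some run exists, and what is never taken back
can be judged already now. -/
theorem LegalFrom.exists_le (h : LegalFrom 𝒜 k N s) : ∃ t, s.Le t ∧ LegalRun 𝒜 k t := by
  obtain ⟨t, ht⟩ := (playRounds 𝒜 C N s).support_nonempty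
  exact ⟨t, le_of_mem_playRounds ht, h t ht⟩

theorem LegalFrom.failed (h : LegalFrom 𝒜 k N s) : s.failed = false := by
  obtain ⟨t, h1, h2⟩ := h.exists_le
  by_contra hf
  simpa [h2.1] using h1.failed (by simpa using hf)

theorem LegalFrom.guess_isSome (h : LegalFrom 𝒜 k 0 s) : s.guess.isSome :=
  (h s ((PMF.mem_support_pure_iff _ _).2 rfl)).2.1

/-- The round about to be played must fit into the time bound too; this limits the cost of
simulating it. -/
theorem LegalFrom.advance_time_le (h : LegalFrom 𝒜 k (N + 1) s) (hg : s.guess = none) :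
    (s.advance 𝒜).time ≤ 𝒜.bound.eval k := by
  obtain ⟨u, hu⟩ := (playRound 𝒜 C s).support_nonempty
  obtain ⟨t, h1, h2⟩ := (h.next hu).exists_le
  rw [← time_eq_of_mem_playRound hg h.failed hu]
  exact h1.time.trans h2.2.2.1

theorem LegalFrom.admissible (h : LegalFrom 𝒜 k N s) {c : C.Chal} (hc : s.chal = some c) :
    C.Admissible c := by
  obtain ⟨t, h1, h2⟩ := h.exists_le
  exact (h2.2.2.2 c (h1.chal c hc)).1

end rounds

theorem size_encZ_le {p : ℕ} [NeZero p] (x : ZMod p) : (encZ x).size ≤ (num p).size :=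
  size_num_le (ZMod.val_lt x).le

namespace Ctx

variable {B : BilinearGenerator} {c : Ctx B} {x xA : Data}

theorem size_num_p_le : (num (B.p c.i)).size ≤ c.start.size := by
  simp only [start, encPK, ofList, size]; omega

theorem Input.size_le (h : c.Input x xA) {b u : ℕ} (hA : xA.size ≤ b) (hs : c.start.size ≤ b)
    (hn : c.n ≤ u) : x.size ≤ 6 * b + u + 30 := by
  have hp := size_num_p_le (c := c)
  have hw := size_encZ_le c.w
  have hρ := size_encZ_le c.ρ
  have h3 : Nat.size 3 = 2 := by decide
  have h2 : Nat.size 2 = 2 := by decide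
  cases h with
  | start => simp only [Data.size] at *; omega
  | forward mem inbox => simp only [Data.size, state, env, Nat.size_zero] at *; omega
  | reply mem M j hI ct =>
    have hy : Nat.size (M.ψ j) ≤ u :=
      (Nat.size_le_size ((M.ψ j).2.le.trans hn)).trans (Nat.size_le.2 (Nat.lt_pow_self one_lt_two))
    -- The stored policy is part of the ciphertext that the simulated adversary is given to read.
    have hM : (encLSSS M).size ≤ (encCT (reconstruct c.pk j c.w c.ρ ct)).size := by
      simp only [encCT, ofList, Data.size]; omega
    simp only [Data.size, state, env, encAttr, Ctx.reply, ofList] at *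
    omega

end Ctx

theorem pmf_bind_congr {α β : Type} {p : PMF α} {f g : α → PMF β}
    (h : ∀ a ∈ p.support, f a = g a) : p.bind f = p.bind g := by
  ext b
  rw [PMF.bind_apply, PMF.bind_apply]
  refine tsum_congr fun a => ?_
  by_cases ha : p a = 0
  · rw [ha, zero_mul, zero_mul]
  · rw [h a ((PMF.mem_support_iff _ _).2 ha)]

/-- The challenge that the reduction makes of a challenge in the contraction game. -/
def Chal₂.contract {B : BilinearGenerator} {i : B.ι} {n : ℕ} (c : Chal₂ B i n) : Chal₁ B i n :=
  ⟨c.M₀, c.M₁, c.M.contract c.j⟩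

/-! ### Round by round simulation of the contraction game -/

section simulation

variable {B : BilinearGenerator} {U : ℕ → ℕ} {k : ℕ} {i : B.ι} {pk : PublicKey B i (U k)}
  {msk : B.G i} {b : Bool} {𝒜 𝒜' : Adversary}

theorem request_enc_injective :
    Function.Injective (Request.enc (n := U k) (G₁ B U k i pk msk b).encChal) := by
  refine Request.enc_injective ?_
  rintro ⟨m₀, m₁, M⟩ ⟨m₀', m₁', M'⟩ h
  have h := ofList_injective h
  simp only [List.cons.injEq, and_true] at h
  rw [B.encGT_injective i h.1, B.encGT_injective i h.2.1, encLSSS_injective h.2.2]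

/-- The knowledge of the reduction in a run of the game. -/
def runCtx (k : ℕ) (pk : PublicKey B i (U k)) (ω : ZMod (B.p i) × ZMod (B.p i)) : Ctx B :=
  ⟨i, U k, unary k, pk, ω.1, ω.2⟩

/-- A configuration of the contraction game and one of the standard game that simulates it after
time at most `τ`, with the random exponents `ω`. -/
structure Simulates (ω : ZMod (B.p i) × ZMod (B.p i)) (τ : ℕ)
    (s : Config (G₂ B U k i pk msk b)) (s' : Config (G₁ B U k i pk msk b)) : Prop where
  guess : s'.guess = s.guess
  failed : s'.failed = false
  queries : s'.queries = s.queries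
  chal : ∀ c', s'.chal = some c' → ∃ c, s.chal = some c ∧ Chal₂.contract c = c'
  input : s.guess = none →
    (runCtx k pk ω).Input (.cons s'.memory s'.inbox) (.cons s.memory s.inbox)
  time : s'.time ≤ τ

/-- A query authorized under the contracted matrix would satisfy the contracted access structure,
against the rules of the contraction game. -/
theorem Simulates.legalRun {ω : ZMod (B.p i) × ZMod (B.p i)} {τ : ℕ}
    {s : Config (G₂ B U k i pk msk b)} {s' : Config (G₁ B U k i pk msk b)}
    (h : Simulates ω τ s s') (hs : LegalRun 𝒜 k s) (hτ : τ ≤ 𝒜'.bound.eval k) :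
    LegalRun 𝒜' k s' := by
  refine ⟨h.failed, h.guess ▸ hs.2.1, h.time.trans hτ, fun c hc => ?_⟩
  obtain ⟨d, hd, rfl⟩ := h.chal c hc
  obtain ⟨h1, h2⟩ := hs.2.2.2 d hd
  refine ⟨h1.1, fun S hS hsat => h2 S (h.queries ▸ hS) ?_⟩
  change S ∩ (d.M.contract d.j).participants ∈ (d.M.contract d.j).access at hsat
  have := LSSS.mem_contraction d.ideal hsat
  rwa [LSSS.participants_contract d.ideal] at this

/-- The reduction plays the standard game like the adversary plays the contraction game. -/
def Faithful (𝒜 𝒜' : Adversary) {Ω : Type} (W : PMF Ω) (N N' : ℕ)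
    (s : Config (G₂ B U k i pk msk b)) (f : Ω → Config (G₁ B U k i pk msk b)) : Prop :=
  (∀ ω, LegalFrom 𝒜' k N' (f ω)) ∧
  (W.bind fun ω => (playRounds 𝒜' (G₁ B U k i pk msk b) N' (f ω)).map Config.guess) =
    (playRounds 𝒜 (G₂ B U k i pk msk b) N s).map Config.guess

/-- Both games draw the same `z` by a law not depending on `ω`, so the two draws can be interchanged
and each `z` treated separately. -/
theorem Faithful.step {Ω Z : Type} {W : PMF Ω} {N N' : ℕ} {s : Config (G₂ B U k i pk msk b)}
    {f : Ω → Config (G₁ B U k i pk msk b)} (D : PMF Z) {t : Z → Config (G₂ B U k i pk msk b)}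
    {t' : Ω → Z → Config (G₁ B U k i pk msk b)} (h : playRound 𝒜 _ s = D.map t)
    (h' : ∀ ω, playRound 𝒜' _ (f ω) = D.map (t' ω))
    (ih : ∀ z ∈ D.support, Faithful 𝒜 𝒜' W N N' (t z) fun ω => t' ω z) :
    Faithful 𝒜 𝒜' W (N + 1) (N' + 1) s f := by
  constructor
  · intro ω u hu
    rw [playRounds, h', PMF.mem_support_bind_iff] at hu
    obtain ⟨v, hv, hu⟩ := hu
    obtain ⟨z, hz, rfl⟩ := (PMF.mem_support_map_iff _ _ _).1 hv
    exact (ih z hz).1 ω u hu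
  · simp only [playRounds, h, h', PMF.bind_map, PMF.map_bind, Function.comp_apply]
    rw [PMF.bind_comm]
    exact pmf_bind_congr fun z hz => (ih z hz).2

/-- Until the challenge, one configuration `s` is matched with a family indexed by the hidden
exponents `ω`, as the simulated adversary learns nothing about them. At the challenge, `hdist` says
that averaging over `ω` and the ciphertext gives the true reply; from then on `ω` is fixed. Extra
rounds do no harm, because play stops with the guess. -/
theorem faithful (K T : ℕ)
    (hT : ∀ ω x y, (runCtx k pk ω).Transition 𝒜 K x y → x.size ≤ K →
      𝒜'.step x = y ∧ 𝒜'.time x ≤ T)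
    (hK : ∀ ω x xA, (runCtx k pk ω).Input x xA → 𝒜.time xA ≤ 𝒜.bound.eval k → x.size ≤ K)
    (hb : 𝒜.bound.eval k ≤ K) (N : ℕ) :
    ∀ (N' : ℕ) (Ω : Type) (W : PMF Ω) (φ : Ω → ZMod (B.p i) × ZMod (B.p i)) (τ : ℕ)
      (s : Config (G₂ B U k i pk msk b)) (f : Ω → Config (G₁ B U k i pk msk b)),
      N ≤ N' → (∀ ω, ω ∈ W.support) → τ + N * T ≤ 𝒜'.bound.eval k →
      (∀ ω, Simulates (φ ω) τ s (f ω)) →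
      (s.chal = none → ∀ c : Chal₂ B i (U k), (G₂ B U k i pk msk b).Admissible c →
        (W.bind fun ω => (encrypt pk (if b then c.M₁ else c.M₀) (c.M.contract c.j)).map
          fun ct => (runCtx k pk (φ ω)).reply c.j ct) = (G₂ B U k i pk msk b).chalReply c) →
      LegalFrom 𝒜 k N s → Faithful 𝒜 𝒜' W N N' s f := by
  have halted : ∀ {N N' : ℕ} {Ω : Type} {W : PMF Ω} {φ : Ω → ZMod (B.p i) × ZMod (B.p i)} {τ : ℕ}
      {s : Config (G₂ B U k i pk msk b)} {f : Ω → Config (G₁ B U k i pk msk b)},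
      s.guess.isSome → τ ≤ 𝒜'.bound.eval k → (∀ ω, Simulates (φ ω) τ s (f ω)) →
      LegalFrom 𝒜 k N s → Faithful 𝒜 𝒜' W N N' s f := by
    intro N N' Ω W φ τ s f hg hτ hs hl
    have hg' : ∀ ω, (f ω).guess.isSome := fun ω => (hs ω).guess ▸ hg
    constructor
    · intro ω t ht
      rw [playRounds_of_halted (.inl (hg' ω)), PMF.mem_support_pure_iff] at ht
      refine ht ▸ (hs ω).legalRun (hl s ?_) hτ
      rw [playRounds_of_halted (.inl hg), PMF.mem_support_pure_iff]
    · simp only [playRounds_of_halted (.inl (hg' _)), playRounds_of_halted (.inl hg), PMF.pure_map,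
        (hs _).guess, PMF.bind_const]
  induction N with
  | zero =>
    intro N' Ω W φ τ s f _ _ hτ hs _ hl
    exact halted hl.guess_isSome (by omega) hs hl
  | succ N ih =>
    intro N' Ω W φ τ s f hN hW hτ hs hdist hl
    by_cases hg' : s.guess.isSome
    · exact halted hg' (le_trans (Nat.le_add_right _ _) hτ) hs hl
    have hg : s.guess = none := by simpa using hg'
    obtain ⟨N', rfl⟩ : ∃ M, N' = M + 1 := ⟨N' - 1, by omega⟩
    have hN : N ≤ N' := by omega
    have hτ' : τ + T + N * T ≤ 𝒜'.bound.eval k := by rw [add_mul, one_mul] at hτ; omega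
    have hf := hl.failed
    have hgf : ∀ ω, (f ω).guess = none := fun ω => (hs ω).guess.trans hg
    have hff : ∀ ω, (f ω).failed = false := fun ω => (hs ω).failed
    have htA : 𝒜.time (.cons s.memory s.inbox) ≤ 𝒜.bound.eval k :=
      (Nat.le_add_left _ _).trans (hl.advance_time_le hg)
    have hstep : ∀ ω y, (runCtx k pk (φ ω)).Output (𝒜.step (.cons s.memory s.inbox)) y →
        𝒜'.step (.cons (f ω).memory (f ω).inbox) = y ∧
          𝒜'.time (.cons (f ω).memory (f ω).inbox) ≤ T := fun ω y hy =>
      hT _ _ _ (.simulate _ _ _ ((hs ω).input hg) hy (htA.trans hb))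
        (hK _ _ _ ((hs ω).input hg) htA)
    have hreq : ∀ ω r', Request.enc (G₁ B U k i pk msk b).encChal r' =
        (𝒜'.step (.cons (f ω).memory (f ω).inbox)).tail → (f ω).request 𝒜' = some r' := by
      intro ω r' h
      rw [Config.request, ← h]
      exact Function.partialInv_left request_enc_injective r'
    cases hr : s.request 𝒜 with
    | none =>
      -- An ill-formed request would mark the run as failed, which legality excludes.
      have := (hl.next (t := _) (by
        rw [playRound_none hg hf hr, PMF.mem_support_pure_iff])).failed
      simp at this
    | some r =>
      have he := eq_of_partialInv_eq_some hr
      have hforward : (𝒜.step (.cons s.memory s.inbox)).tail.head ≠ .num 2 → ∀ ω,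
          (𝒜'.step (.cons (f ω).memory (f ω).inbox)).head =
            (runCtx k pk (φ ω)).state (𝒜.step (.cons s.memory s.inbox)).head (.num 0) ∧
          (𝒜'.step (.cons (f ω).memory (f ω).inbox)).tail =
            (𝒜.step (.cons s.memory s.inbox)).tail ∧
          ((f ω).advance 𝒜').time ≤ τ + T := fun h ω => by
        obtain ⟨h1, h2⟩ := hstep ω _ (.forward h)
        exact ⟨by rw [h1]; rfl, by rw [h1]; rfl, Nat.add_le_add (hs ω).time h2⟩
      cases r with
      | sample m =>
        have h := hforward (by rw [← he]; simp [Request.enc])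
        have hr' : ∀ ω, (f ω).request 𝒜' = some (.sample m) := fun ω =>
          hreq ω (.sample m) ((h ω).2.1 ▸ he)
        refine Faithful.step _ (playRound_sample hg hf hr)
          (fun ω => playRound_sample (hgf ω) (hff ω) (hr' ω)) fun z hz => ?_
        refine ih N' Ω W φ (τ + T) _ _ hN hW hτ' (fun ω => ⟨(hs ω).guess, hff ω, (hs ω).queries,
          (hs ω).chal, fun _ => ?_, (h ω).2.2⟩) hdist (hl.next ?_)
        · have := Ctx.Input.forward (c := runCtx k pk (φ ω))
            (𝒜.step (.cons s.memory s.inbox)).head (.num z)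
          rw [← (h ω).1] at this
          exact this
        · rw [playRound_sample hg hf hr]
          exact (PMF.mem_support_map_iff _ _ _).2 ⟨z, hz, rfl⟩
      | key S =>
        have h := hforward (by rw [← he]; simp [Request.enc])
        have hr' : ∀ ω, (f ω).request 𝒜' = some (.key S) := fun ω =>
          hreq ω (.key S) ((h ω).2.1 ▸ he)
        refine Faithful.step _ (playRound_key hg hf hr)
          (fun ω => playRound_key (hgf ω) (hff ω) (hr' ω)) fun z hz => ?_
        refine ih N' Ω W φ (τ + T) _ _ hN hW hτ' (fun ω => ⟨(hs ω).guess, hff ω,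
          congrArg (List.cons S) (hs ω).queries, (hs ω).chal, fun _ => ?_, (h ω).2.2⟩) hdist
          (hl.next ?_)
        · have := Ctx.Input.forward (c := runCtx k pk (φ ω))
            (𝒜.step (.cons s.memory s.inbox)).head z
          rw [← (h ω).1] at this
          exact this
        · rw [playRound_key hg hf hr]
          exact (PMF.mem_support_map_iff _ _ _).2 ⟨z, hz, rfl⟩
      | guess g =>
        have h := hforward (by rw [← he]; simp [Request.enc])
        have hr' : ∀ ω, (f ω).request 𝒜' = some (.guess g) := fun ω =>
          hreq ω (.guess g) ((h ω).2.1 ▸ he)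
        -- A round without randomness counts as a draw from a one-point distribution.
        refine Faithful.step (PMF.pure ()) (t := fun _ => { s.advance 𝒜 with guess := some g })
          (t' := fun ω _ => { (f ω).advance 𝒜' with guess := some g })
          (by rw [playRound_guess hg hf hr, PMF.pure_map])
          (fun ω => by rw [playRound_guess (hgf ω) (hff ω) (hr' ω), PMF.pure_map])
          fun z hz => ?_
        refine ih N' Ω W φ (τ + T) _ _ hN hW hτ' (fun ω => ⟨rfl, hff ω, (hs ω).queries,
          (hs ω).chal, fun hc => by simp at hc, (h ω).2.2⟩) hdist (hl.next ?_)
        rw [playRound_guess hg hf hr, PMF.mem_support_pure_iff]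
      | challenge c =>
        by_cases hc' : s.chal.isSome
        · have := (hl.next (t := _) (by
            rw [playRound_challenge_of_isSome hg hf hr hc', PMF.mem_support_pure_iff])).failed
          simp at this
        have hc : s.chal = none := by simpa using hc'
        have hp := playRound_challenge hg hf hr hc
        have hnext : ∀ v ∈ ((G₂ B U k i pk msk b).chalReply c).support, LegalFrom 𝒜 k N
            { s.advance 𝒜 with inbox := v, chal := some c } := fun v hv =>
          hl.next (by rw [hp]; exact (PMF.mem_support_map_iff _ _ _).2 ⟨v, hv, rfl⟩)
        -- The challenge survives to the end of some legal run, hence it is admissible.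
        have hadm : (G₂ B U k i pk msk b).Admissible c := by
          obtain ⟨v, hv⟩ := ((G₂ B U k i pk msk b).chalReply c).support_nonempty
          exact (hnext v hv).admissible rfl
        have hd := hdist hc c hadm
        have h := fun ω => hstep ω _ (Ctx.Output.challenge (c := runCtx k pk (φ ω))
          (Chal₂.M₀ c) (Chal₂.M₁ c) (Chal₂.M c) (Chal₂.j c) (Chal₂.ideal c) he.symm)
        have hr' : ∀ ω, (f ω).request 𝒜' = some (.challenge (Chal₂.contract c)) := fun ω =>
          hreq ω (.challenge (Chal₂.contract c)) (by rw [(h ω).1]; rfl)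
        have hp' : ∀ ω, playRound 𝒜' (G₁ B U k i pk msk b) (f ω) =
            (encrypt pk (if b then c.M₁ else c.M₀) (c.M.contract c.j)).map fun ct =>
              { (f ω).advance 𝒜' with inbox := encCT ct, chal := some (Chal₂.contract c) } := by
          intro ω
          rw [playRound_challenge (hgf ω) (hff ω) (hr' ω)]
          · exact PMF.map_comp _ _ _
          · by_contra hne
            obtain ⟨c', hc'⟩ := Option.ne_none_iff_exists'.1 hne
            obtain ⟨d, hd, -⟩ := (hs ω).chal c' hc'
            simp [hc] at hd
        have key : ∀ ω, ∀ ct ∈ (encrypt pk (if b then c.M₁ else c.M₀) (c.M.contract c.j)).support,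
            Faithful 𝒜 𝒜' (PMF.pure ()) N N'
              { s.advance 𝒜 with inbox := (runCtx k pk (φ ω)).reply c.j ct, chal := some c }
              fun _ => { (f ω).advance 𝒜' with
                inbox := encCT ct, chal := some (Chal₂.contract c) } := by
          intro ω ct hct
          -- After the challenge the view depends on `ω`, so the induction continues for each `ω`
          -- and ciphertext with a one-point distribution.
          refine ih N' Unit _ (fun _ => φ ω) (τ + T) _ _ hN (by simp) hτ' (fun _ => ⟨(hs ω).guess,
            hff ω, (hs ω).queries, fun c' h' => ⟨c, rfl, Option.some.inj h'⟩, fun _ => ?_,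
            Nat.add_le_add (hs ω).time (h ω).2⟩) (fun h => by simp at h) (hnext _ ?_)
          · have := Ctx.Input.reply (c := runCtx k pk (φ ω))
              (𝒜.step (.cons s.memory s.inbox)).head c.M c.j c.ideal ct
            have e := congrArg Data.head (h ω).1
            rw [head_cons] at e
            rw [← e] at this
            exact this
          -- The simulated reply is a possible true reply, as `ω` has positive probability; legality
          -- therefore persists.
          · rw [← hd]
            exact (PMF.mem_support_bind_iff _ _ _).2
              ⟨ω, hW ω, (PMF.mem_support_map_iff _ _ _).2 ⟨ct, hct, rfl⟩⟩
        constructor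
        · intro ω u hu
          rw [playRounds, hp', PMF.mem_support_bind_iff] at hu
          obtain ⟨v, hv, hu⟩ := hu
          obtain ⟨ct, hct, rfl⟩ := (PMF.mem_support_map_iff _ _ _).1 hv
          exact (key ω ct hct).1 () u hu
        · simp only [playRounds, hp, hp']
          rw [← hd]
          simp only [PMF.bind_map, PMF.map_bind, PMF.bind_bind]
          refine congrArg _ (funext fun ω => (pmf_bind_congr fun ct hct => ?_).trans
            (PMF.bind_map _ _ _).symm)
          have := (key ω ct hct).2
          rw [PMF.pure_bind] at this
          exact this

end simulation

/-- A random number below a prime as a random exponent. -/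
theorem uniform_fin_bind {δ : Type} (p : ℕ) [hp : Fact p.Prime] (F : Data → PMF δ) :
    ((PMF.uniformOfFintype (Fin (p - 1 + 1))).bind fun r => F (num r.val)) =
      (PMF.uniformOfFintype (ZMod p)).bind fun w => F (encZ w) := by
  have hpos := hp.out.pos
  have hval : ∀ r : Fin (p - 1 + 1), ((r.val : ℕ) : ZMod p).val = r.val := fun r =>
    ZMod.val_cast_of_lt (by omega)
  have hbij : Function.Bijective fun r : Fin (p - 1 + 1) => ((r.val : ℕ) : ZMod p) := by
    refine (Fintype.bijective_iff_injective_and_card _).2 ⟨fun r r' h => Fin.ext ?_, ?_⟩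
    · rw [← hval r, ← hval r']; exact congrArg ZMod.val h
    · rw [Fintype.card_fin, ZMod.card]; omega
  rw [← uniformOfFintype_bind hbij]
  simp only [encZ, hval]

theorem uniform_prod_bind {α β δ : Type} [Fintype α] [Nonempty α] [Fintype β] [Nonempty β]
    (F : α × β → PMF δ) : (PMF.uniformOfFintype (α × β)).bind F =
      (PMF.uniformOfFintype α).bind fun a => (PMF.uniformOfFintype β).bind fun b => F (a, b) := by
  rw [← uniformOfFintype_bind_map (f := Prod.mk (α := α) (β := β)) Function.bijective_id,
    PMF.bind_bind]
  simp only [PMF.bind_map]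
  rfl

/-! ### Equality of the two experiments -/

section

variable {B : BilinearGenerator} {U : ℕ → ℕ} {k : ℕ} {i : B.ι} {pk : PublicKey B i (U k)}
  {msk : B.G i} {b : Bool} {𝒜 𝒜' : Adversary}

theorem chalReply_eq {c : Chal₂ B i (U k)} (hc : (G₂ B U k i pk msk b).Admissible c) :
    ((PMF.uniformOfFintype (ZMod (B.p i) × ZMod (B.p i))).bind fun ω =>
      (encrypt pk (if b then c.M₁ else c.M₀) (c.M.contract c.j)).map
        fun ct => (runCtx k pk ω).reply c.j ct) = (G₂ B U k i pk msk b).chalReply c := by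
  obtain ⟨h0, h⟩ := LSSS.pivot_spec c.ideal hc.2.1 hc.2.2
  have := congrArg (PMF.map fun y : Ciphertext B i c.M × Ciphertext B i (c.M.contract c.j) ×
      ZMod (B.p i) => Data.ofList [encCT y.1, encCT y.2.1, encZ y.2.2])
    (reconstruct_distribution pk (if b then c.M₁ else c.M₀) h0 h)
  rw [uniform_prod_bind]
  simp only [PMF.map_bind, PMF.map_comp] at this
  exact this

theorem playRounds_ask {s : Config (G₁ B U k i pk msk b)} (hg : s.guess = none)
    (hf : s.failed = false) (h : (𝒜'.step (.cons s.memory s.inbox)).tail =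
      .cons (.num 0) (.num (B.p i - 1))) (N : ℕ) :
    playRounds 𝒜' (G₁ B U k i pk msk b) (N + 1) s =
      (PMF.uniformOfFintype (ZMod (B.p i))).bind fun w =>
        playRounds 𝒜' (G₁ B U k i pk msk b) N { s.advance 𝒜' with inbox := encZ w } := by
  have hr : s.request 𝒜' = some (.sample (B.p i - 1)) := by
    rw [Config.request, h]
    exact Function.partialInv_left request_enc_injective (.sample (B.p i - 1))
  rw [playRounds, playRound_sample hg hf hr, PMF.bind_map]
  exact uniform_fin_bind (B.p i) fun d => playRounds 𝒜' _ N { s.advance 𝒜' with inbox := d }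

/-- Two rounds fetch `w` and `ρ`; then the simulation starts from the adversary's own initial
configuration. In `hτ` the first summand covers the total time, the second the number of rounds. -/
theorem play_eq (K T : ℕ)
    (hT : ∀ ω x y, (runCtx k pk ω).Transition 𝒜 K x y → x.size ≤ K →
      𝒜'.step x = y ∧ 𝒜'.time x ≤ T)
    (hK : 6 * 𝒜.bound.eval k + U k + 30 ≤ K)
    (hτ : (𝒜.bound.eval k + 2) * T + (𝒜.bound.eval k + 2) ≤ 𝒜'.bound.eval k)
    (hl : ∀ s ∈ (play 𝒜 (G₂ B U k i pk msk b) k (encPK pk)).support, LegalRun 𝒜 k s) :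
    (∀ s ∈ (play 𝒜' (G₁ B U k i pk msk b) k (encPK pk)).support, LegalRun 𝒜' k s) ∧
      (play 𝒜' (G₁ B U k i pk msk b) k (encPK pk)).map Config.guess =
        (play 𝒜 (G₂ B U k i pk msk b) k (encPK pk)).map Config.guess := by
  have hl' : LegalFrom 𝒜 k (𝒜.bound.eval k) _ := hl
  -- A legal adversary plays at least one round, in which it has to read `1^k` and the public key;
  -- its own time bound thus dominates their length.
  have hstart : ∀ ω, (runCtx k pk ω).start.size + 2 ≤ 𝒜.bound.eval k := fun ω => by
    cases hN : 𝒜.bound.eval k with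
    | zero =>
      rw [hN] at hl'
      have := hl'.guess_isSome
      simp at this
    | succ N =>
      rw [hN] at hl'
      have h1 := hl'.advance_time_le rfl
      have h2 := (𝒜.runs (.cons (.num 0) (runCtx k pk ω).start)).size_lt.1
      have h3 : 0 + 𝒜.time (.cons (.num 0) (runCtx k pk ω).start) ≤ 𝒜.bound.eval k := h1
      simp only [Data.size] at h2
      omega
  have hw : ∀ w : ZMod (B.p i), (encZ w).size ≤ 𝒜.bound.eval k := fun w => by
    have h1 := size_encZ_le w
    have h2 := Ctx.size_num_p_le (c := runCtx k pk (w, w))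
    have h3 := hstart (w, w)
    exact h1.trans (h2.trans (by omega))
  have h1 : ∀ ω, _ := fun ω => hT ω _ _ .first (by
    have := hstart ω
    simp only [Data.size, Nat.size_zero]; omega)
  have h2 : ∀ ω, _ := fun ω => hT ω _ _ .second (by
    have := hstart ω
    have : (encZ (runCtx k pk ω).w).size ≤ 𝒜.bound.eval k := hw ω.1
    simp only [Data.size, Nat.size_one]; omega)
  obtain ⟨N', hN'⟩ : ∃ N', 𝒜'.bound.eval k = N' + 1 + 1 := ⟨𝒜'.bound.eval k - 2, by omega⟩
  -- The first input does not depend on the exponents, so any values will do here.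
  let t₁ := 𝒜'.time (.cons (.num 0) (runCtx k pk (0, 0)).start)
  let f : ZMod (B.p i) × ZMod (B.p i) → Config (G₁ B U k i pk msk b) := fun ω =>
    { memory := .cons (.num 2) (.cons (runCtx k pk ω).start (encZ ω.1)), inbox := encZ ω.2,
      time := t₁ + 𝒜'.time (.cons (.cons (.num 1) (runCtx k pk ω).start) (encZ ω.1)),
      queries := [], chal := none, guess := none, failed := false }
  have hplay : play 𝒜' (G₁ B U k i pk msk b) k (encPK pk) =
      (PMF.uniformOfFintype (ZMod (B.p i) × ZMod (B.p i))).bind fun ω =>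
        playRounds 𝒜' (G₁ B U k i pk msk b) N' (f ω) := by
    rw [play, hN', playRounds_ask rfl rfl, uniform_prod_bind]
    · refine congrArg _ (funext fun w => ?_)
      have e : (𝒜'.step (.cons (.num 0) (.cons (.unary k) (encPK pk)))).head =
        .cons (.num 1) (runCtx k pk (w, 0)).start := congrArg Data.head (h1 (w, 0)).1
      have e' := (h2 (w, 0)).1
      simp only [Config.advance, e, zero_add]
      rw [playRounds_ask rfl rfl]
      · refine congrArg _ (funext fun ρ => ?_)
        simp only [Config.advance]
        congr 2
        exact congrArg Data.head e'
      · exact congrArg Data.tail e'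
    · exact congrArg Data.tail (h1 (0, 0)).1
  have hfaith := faithful (msk := msk) (b := b) (𝒜' := 𝒜') K T hT
    (fun ω x xA hx hA => (hx.size_le ((𝒜.runs xA).size_lt.1.le.trans hA)
      (by have := hstart ω; omega) le_rfl).trans hK) (by omega) (𝒜.bound.eval k) N' _
    (PMF.uniformOfFintype (ZMod (B.p i) × ZMod (B.p i))) (fun ω => ω) (T + T) _ f
    (by rw [add_mul] at hτ; omega) (by simp) (by rw [add_mul] at hτ; omega)
    (fun ω => ⟨rfl, rfl, rfl, fun c' h => by simp [f] at h, fun _ => .start,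
      Nat.add_le_add (h1 (0, 0)).2 (h2 ω).2⟩) (fun _ c hc => chalReply_eq hc) hl'
  constructor
  · intro s hs
    rw [hplay, PMF.mem_support_bind_iff] at hs
    obtain ⟨ω, -, hs⟩ := hs
    exact hfaith.1 ω s hs
  · rw [hplay, PMF.map_bind]
    exact hfaith.2

end

end CPABE

end

/-! ### The reduction and its advantage -/

theorem theorem3 (B : CPABE.BilinearGenerator) (U : ℕ → ℕ)
    (hU : ∃ q : Polynomial ℕ, ∀ k, U k ≤ q.eval k)
    (hWaters : CPABE.Secure (CPABE.G₁ B U)) :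
    CPABE.Secure (CPABE.G₂ B U) := by
  intro 𝒜 hlegal
  obtain ⟨u, hu⟩ := hU
  obtain ⟨q, hq⟩ := B.poly_length
  obtain ⟨code, step, time, Q, hruns, hred⟩ := CPABE.exists_reduction B 𝒜
  -- The terms with `𝒜.bound` and `u` and the constant come from `Ctx.Input.size_le`; `q` bounds the
  -- codes of group elements.
  let K : Polynomial ℕ := 6 * 𝒜.bound + u + q + 30
  let 𝒜' : CPABE.Adversary :=
    ⟨code, step, time, hruns, (𝒜.bound + 2) * Q.comp K + (𝒜.bound + 2)⟩
  have hK : ∀ k, K.eval k = 6 * 𝒜.bound.eval k + u.eval k + q.eval k + 30 := fun k => by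
    simp [K]
  have hb : ∀ k, 𝒜'.bound.eval k =
      (𝒜.bound.eval k + 2) * Q.eval (K.eval k) + (𝒜.bound.eval k + 2) := fun k => by
    simp [𝒜']
  have key : ∀ k, ∀ i ∈ (B.gen k).support, ∀ keys ∈ (CPABE.setup i (U k)).support, ∀ b, _ :=
    fun k i hi keys hkeys b => CPABE.play_eq (𝒜' := 𝒜') (K.eval k) (Q.eval (K.eval k))
      (fun ω x y h hx => hred _ _ x y h hx fun g => ((hq k i hi).2.2.1 g).trans (by
        rw [hK]; omega))
      (by have := hu k; rw [hK]; omega) (hb k).ge (hlegal k i hi keys hkeys b)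
  -- The guesses agree in law for every group, key pair and bit, so the advantages are equal and no
  -- loss enters `ν`.
  have hexp : ∀ k, CPABE.experiment (CPABE.G₁ B U) 𝒜' k =
      CPABE.experiment (CPABE.G₂ B U) 𝒜 k := fun k =>
    CPABE.pmf_bind_congr fun i hi => CPABE.pmf_bind_congr fun keys hkeys =>
      CPABE.pmf_bind_congr fun b _ => by
        have := congrArg (PMF.map fun g => g == some b) (key k i hi keys hkeys b).2
        rw [PMF.map_comp, PMF.map_comp] at this
        exact this
  obtain ⟨ν, hν, hle⟩ := hWaters 𝒜' fun k i hi keys hkeys b => (key k i hi keys hkeys b).1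
  refine ⟨ν, hν, fun k => ?_⟩
  have := hle k
  rwa [CPABE.advantage, hexp] at this
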